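/- \textbf{Setting.} Consider an episodic MDP with state space $\mathcal S$ (a measurable space), finite non-empty action set $\mathcal A$, horizon $H\ge 1$, transition kernels $P_h$, deterministic rewards $r_h\ge 0$ with $\sum_{h=1}^H r_h(s_h,a_h)\le 1$ for all sequences of states and actions, and fixed initial state $s_1$. For a deterministic policy $\pi$ let $V_h^\pi,Q_h^\pi$ be its value functions, $V^\star_h=\sup_\pi V^\pi_h$, $Q^\star_h=\sup_\pi Q^\pi_h$; $\pi$ is $\epsilon$-optimal if $V_1^\pi(s_1)\ge V_1^\star(s_1)-\epsilon$. Let $\mathcal F=\mathcal F_1\times\dots\times\mathcal F_H$ be a finite class of (measurable) functions $\mathcal F_h\subseteq(\mathcal S\times\mathcal A\to[0,1])$ with $|\mathcal F|\ge 2$, with the convention $f_{H+1}=0$, and for $f\in\mathcal F$ let $\pi_f$ be a (measurable) greedy policy, $\pi_{f,h}(s)\in\arg\max_a f_h(s,a)$. Put $(\mathcal T_h g)(s,a)=r_h(s,a)+\mathbb E_{s'\sim P_h(\cdot\mid s,a)}\max_{a'}g(s',a')$. \textbf{Dimension.} For a class $\mathcal G$ of real functions on $\mathcal X$, a probability measure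 $\nu$ is $\epsilon$-independent of $\mu_1,\dots,\mu_n$ if some $g\in\mathcal G$ has $\sqrt{\sum_i(\mathbb E_{\mu_i}g)^2}\le\epsilon$ and $|\mathbb E_\nu g|>\epsilon$. For a family $\Pi$ of probability measures, $\dim_{\rm DE}(\mathcal G,\Pi,\epsilon)$ is the length of the longest sequence in $\Pi$ such that for some $\epsilon'\ge\epsilon$ every element is $\epsilon'$-independent of its predecessors. Let $\mathcal G_h=\{s\mapsto (f_h-\mathcal T_hf_{h+1})(s,\pi_{f,h}(s)):f\in\mathcal F\}$, let $\mathcal D_{\mathcal F,h}$ be the set of laws of the state $s_h$ under the policies $\pi_f$, $f\in\mathcal F$, and $\dim_{\rm VBE}(\mathcal F,\mathcal D_{\mathcal F},\epsilon)=\max_h\dim_{\rm DE}(\mathcal G_h,\mathcal D_{\mathcal F,h},\epsilon)$. \textbf{Algorithm} (V-type OLIVE with parameters $\zeta_{\rm act},\zeta_{\rm elim},n_{\rm act},n_{\rm elim}$). Start with $\mathcal B^0=\mathcal F$. In phase $k=1,2,\dots$: choose $f^k\in\arg\max_{f\in\mathcal B^{k-1}}f_1(s_1,\pi_{f,1}(s_1))$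 and $\pi^k=\pi_{f^k}$. Run $\pi^k$ for $n_{\rm act}$ fresh episodes and let $\tilde{\mathcal E}_h$ be the average over them of $f^k_h(s_h,a_h)-r_h-\max_{a'}f^k_{h+1}(s_{h+1},a')$. If $\sum_h\tilde{\mathcal E}_h\le H\zeta_{\rm act}$, terminate and output $\pi^k$. Otherwise pick any $t$ with $\tilde{\mathcal E}_t>\zeta_{\rm act}$; collect $n_{\rm elim}$ fresh episodes following $\pi^k$ at steps $1,\dots,t-1$ and taking a uniformly random action at step $t$; for each $f$ let $\hat{\mathcal E}(f)$ be the average over them of $|\mathcal A|\,\mathbf 1[a_t=\pi_{f,t}(s_t)]\,(f_t(s_t,a_t)-r_t-\max_{a'}f_{t+1}(s_{t+1},a'))$, and set $\mathcal B^k=\{f\in\mathcal B^{k-1}:|\hat{\mathcal E}(f)|\le\zeta_{\rm elim}\}$. The maximizer may be chosen by any rule depending on $k$ and $\mathcal B^{k-1}$, and $t$ by any (measurable) rule depending on $k$, $\mathcal B^{k-1}$ and the $n_{\rm act}$ episodes just collected. \textbf{Theorem.} There are absolute constants $c,C_1,C_2>0$ such that the following holds for every such MDP and class. Assume realizability, $Q_h^\star\in\mathcal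 F_h$ for all $h$. Let $\epsilon,\delta\in(0,1]$, let $d\ge 1$ be an integer with $\dim_{\rm VBE}(\mathcal F,\mathcal D_{\mathcal F},\epsilon/H)\le d$ (for example $d$ equal to this dimension, if it is not $0$), and assume $Hd|\mathcal A|/(\delta\epsilon)\ge 2$ (automatic if $|\mathcal A|\ge2$). Put $\iota=c\log\big(Hd|\mathcal A|/(\delta\epsilon)\big)$ and $$\zeta_{\rm act}=\frac{2\epsilon}{H},\quad \zeta_{\rm elim}=\frac{\epsilon}{2H\sqrt d},\quad n_{\rm act}=\Big\lceil\frac{H^2\iota}{\epsilon^2}\Big\rceil,\quad n_{\rm elim}=\Big\lceil\frac{H^2d|\mathcal A|\log(|\mathcal F|)\,\iota}{\epsilon^2}\Big\rceil .$$ Then with probability at least $1-\delta$, V-type OLIVE with these parameters terminates, outputs a $C_1\epsilon$-optimal policy, and uses at most $C_2\,H^3d^2|\mathcal A|\log(|\mathcal F|)\,\iota/\epsilon^2$ episodes in total. -/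

import Mathlib

open MeasureTheory ProbabilityTheory

universe u v

noncomputable section

namespace VOlive

/-! ### Episodic Markov decision processes

Steps are numbered `0, 1, …, H - 1` (step `h` here is step `h + 1` in the usual numbering).
Transitions, rewards and policies are indexed by `ℕ`; entries with index `≥ H` play no role. -/

/-- An episodic MDP with horizon `H`, deterministic non-negative rewards whose sum along any
sequence of states and actions is at most `1`, and a fixed initial state. -/
structure MDP (S : Type u) (A : Type v) [MeasurableSpace S] [MeasurableSpace A] (H : ℕ) where
  P : ℕ → Kernel (S × A) S
  markov : ∀ h, IsMarkovKernel (P h)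
  r : ℕ → S → A → ℝ
  measurable_r : ∀ h, Measurable (fun p : S × A => r h p.1 p.2)
  r_nonneg : ∀ h s a, 0 ≤ r h s a
  r_sum_le_one : ∀ (s : ℕ → S) (a : ℕ → A), ∑ h ∈ Finset.range H, r h (s h) (a h) ≤ 1
  init : S

/-- A deterministic (measurable) policy. -/
structure Policy (S : Type u) (A : Type v) [MeasurableSpace S] [MeasurableSpace A] where
  act : ℕ → S → A
  measurable_act : ∀ h, Measurable (act h)

variable {S : Type u} {A : Type v} [MeasurableSpace S] [MeasurableSpace A] {H : ℕ}

/-- A deterministic policy as a sequence of kernels from states to actions. -/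
def Policy.kernel (π : Policy S A) (h : ℕ) : Kernel S A :=
  Kernel.deterministic (π.act h) (π.measurable_act h)

/-- The transition tuple `(s_h, a_h, s_{h+1})` observed at one step. The reward is the
deterministic quantity `r_h(s_h, a_h)`, so it is not stored. -/
abbrev Tuple (S : Type u) (A : Type v) : Type (max u v) := S × A × S

/-- Law of `(s_h, a_h, s_{h+1})` given `s_h`, when `a_h ∼ κ_h(· ∣ s_h)`. -/
def MDP.stepLaw (M : MDP S A H) (κ : ℕ → Kernel S A) (h : ℕ) : Kernel S (Tuple S A) :=
  Kernel.id ×ₖ (κ h ⊗ₖ M.P h)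

/-- Law of the `n` successive tuples of steps `h, …, h + n - 1`, given `s_h`, when the actions
are drawn from the (possibly randomized) Markov policy `κ`. -/
def MDP.trajLaw (M : MDP S A H) (κ : ℕ → Kernel S A) :
    (n : ℕ) → (h : ℕ) → Kernel S (Fin n → Tuple S A)
  | 0, _ => Kernel.const S (Measure.dirac Fin.elim0)
  | n + 1, h =>
      ((M.stepLaw κ h) ⊗ₖ
        ((MDP.trajLaw M κ n (h + 1)).comap (fun p : S × Tuple S A => p.2.2.2)
          (by fun_prop))).map
        (fun q => (Fin.cons q.1 q.2 : Fin (n + 1) → Tuple S A))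

/-- A full episode: the tuples of the steps `0, …, H - 1`. -/
abbrev Episode (S : Type u) (A : Type v) (H : ℕ) : Type (max u v) := Fin H → Tuple S A

/-- Law of an episode from the initial state under the Markov policy `κ`. -/
def MDP.episodeLaw (M : MDP S A H) (κ : ℕ → Kernel S A) : Measure (Episode S A H) :=
  M.trajLaw κ H 0 M.init

/-- Expected sum of the rewards of the steps `h, …, H - 1` when `s_h = s` and actions are drawn
from `κ`. -/
def MDP.expReward (M : MDP S A H) (κ : ℕ → Kernel S A) (h : ℕ) (s : S) : ℝ :=
  ∫ τ, ∑ i : Fin (H - h), M.r (h + i) (τ i).1 (τ i).2.1 ∂(M.trajLaw κ (H - h) h s)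

/-- `V_h^π(s)`. -/
def MDP.value (M : MDP S A H) (π : Policy S A) (h : ℕ) (s : S) : ℝ :=
  M.expReward π.kernel h s

/-- `Q_h^π(s, a)`: the action `a` is taken at step `h`, and `π` is followed afterwards. -/
def MDP.qValue (M : MDP S A H) (π : Policy S A) (h : ℕ) (s : S) (a : A) : ℝ :=
  M.expReward (Function.update π.kernel h (Kernel.const S (Measure.dirac a))) h s

/-- `V_h^⋆(s) = sup_π V_h^π(s)`. -/
def MDP.valueStar (M : MDP S A H) (h : ℕ) (s : S) : ℝ :=
  ⨆ π : Policy S A, M.value π h s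

/-- `Q_h^⋆(s, a) = sup_π Q_h^π(s, a)`. -/
def MDP.qStar (M : MDP S A H) (h : ℕ) (s : S) (a : A) : ℝ :=
  ⨆ π : Policy S A, M.qValue π h s a

/-- `π` is `ε`-optimal. -/
def MDP.IsOptimalUpTo (M : MDP S A H) (ε : ℝ) (π : Policy S A) : Prop :=
  M.valueStar 0 M.init - ε ≤ M.value π 0 M.init

/-! ### Function classes, greedy policies, Bellman residuals -/

/-- A candidate `f = (f_h)_{h < H}`. -/
abbrev QFun (S : Type u) (A : Type v) (H : ℕ) : Type (max u v) := Fin H → S → A → ℝ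

/-- The component `f_h`, with the convention that it is `0` past the last step. -/
def QFun.at (f : QFun S A H) (h : ℕ) : S → A → ℝ :=
  if hh : h < H then f ⟨h, hh⟩ else 0

/-- The product class `F_0 × ⋯ × F_{H-1}`. -/
def productClass (F : Fin H → Set (S → A → ℝ)) : Set (QFun S A H) := Set.univ.pi F

/-- `π` is greedy for `f`: `π_h(s) ∈ argmax_a f_h(s, a)`. -/
def IsGreedy (f : QFun S A H) (π : Policy S A) : Prop :=
  ∀ (h : Fin H) (s : S) (a : A), f h s a ≤ f h s (π.act h s)

/-- The Bellman operator `(T_h g)(s, a) = r_h(s, a) + E_{s' ∼ P_h(· ∣ s, a)} max_{a'} g(s', a')`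
(the supremum is a maximum for finite `A`). -/
def MDP.bellman (M : MDP S A H) (h : ℕ) (g : S → A → ℝ) (s : S) (a : A) : ℝ :=
  M.r h s a + ∫ s', (⨆ a', g s' a') ∂(M.P h (s, a))

/-- The state-wise Bellman residual `s ↦ (f_h - T_h f_{h+1})(s, π_f(s))`, where `π_f = gr f`. -/
def MDP.vResidual (M : MDP S A H) (gr : QFun S A H → Policy S A) (f : QFun S A H) (h : Fin H)
    (s : S) : ℝ :=
  f h s ((gr f).act h s) - M.bellman h (f.at (h + 1)) s ((gr f).act h s)

/-- The class `(I - T_h) V_F` of state-wise Bellman residuals. -/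
def MDP.vResidualClass (M : MDP S A H) (gr : QFun S A H → Policy S A) (F : Set (QFun S A H))
    (h : Fin H) : Set (S → ℝ) :=
  {g | ∃ f ∈ F, g = M.vResidual gr f h}

/-- The family `D_{F,h}` of the laws of the state `s_h` under the greedy policies of `F`. -/
def MDP.rollIn (M : MDP S A H) (gr : QFun S A H → Policy S A) (F : Set (QFun S A H))
    (h : Fin H) : Set (Measure S) :=
  {μ | ∃ f ∈ F, μ = (M.episodeLaw (gr f).kernel).map (fun τ => (τ h).1)}

/-! ### Distributional Eluder dimension and V-type Bellman Eluder dimension -/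

/-- `ν` is `ε`-independent of `μ_0, …, μ_{n-1}` with respect to `G`. -/
def EpsIndependent {X : Type*} [MeasurableSpace X] (G : Set (X → ℝ)) (ε : ℝ) {n : ℕ}
    (μ : Fin n → Measure X) (ν : Measure X) : Prop :=
  ∃ g ∈ G, Real.sqrt (∑ i, (∫ x, g x ∂(μ i)) ^ 2) ≤ ε ∧ ε < |∫ x, g x ∂ν|

/-- The distributional Eluder dimension: the supremum of the lengths `n` of sequences in `Pi`
for which some `ε' ≥ ε` makes every element `ε'`-independent of its predecessors. -/
def deDim {X : Type*} [MeasurableSpace X] (G : Set (X → ℝ)) (Pi : Set (Measure X)) (ε : ℝ) :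
    ℕ∞ :=
  ⨆ n ∈ {n : ℕ | ∃ ρ : ℕ → Measure X, (∀ i < n, ρ i ∈ Pi) ∧
    ∃ ε' ≥ ε, ∀ i < n, EpsIndependent G ε' (fun j : Fin i => ρ j) (ρ i)}, (n : ℕ∞)

/-- The V-type `ε`-Bellman Eluder dimension of `F` with respect to `D_F`. -/
def MDP.vbeDim (M : MDP S A H) (gr : QFun S A H → Policy S A) (F : Set (QFun S A H)) (ε : ℝ) :
    ℕ∞ :=
  ⨆ h : Fin H, deDim (M.vResidualClass gr F h) (M.rollIn gr F h) ε

/-! ### The V-type OLIVE algorithm -/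

/-- The parameters of the algorithm. -/
structure Params where
  zetaAct : ℝ
  zetaElim : ℝ
  nAct : ℕ
  nElim : ℕ

/-- A data set of `n` episodes. -/
abbrev Data (S : Type u) (A : Type v) (H n : ℕ) : Type (max u v) := Fin n → Episode S A H

/-- The law of `n` independent episodes under `κ`. -/
def MDP.dataLaw (M : MDP S A H) (κ : ℕ → Kernel S A) (n : ℕ) : Measure (Data S A H n) :=
  Measure.pi (fun _ => M.episodeLaw κ)

/-- The temporal difference `f_h(s, a) - r_h(s, a) - max_{a'} f_{h+1}(s', a')`. -/
def MDP.tdError (M : MDP S A H) (f : QFun S A H) (h : Fin H) (z : Tuple S A) : ℝ :=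
  f h z.1 z.2.1 - M.r h z.1 z.2.1 - ⨆ a', f.at (h + 1) z.2.2 a'

/-- The on-policy estimate of the Bellman error, used for activation. -/
def MDP.actEstimate (M : MDP S A H) {n : ℕ} (f : QFun S A H) (h : Fin H) (D : Data S A H n) : ℝ :=
  (1 / (n : ℝ)) * ∑ i, M.tdError f h (D i h)

open Classical in
/-- The importance-weighted estimate of the V-type Bellman error, used for elimination. -/
def MDP.elimEstimate [Fintype A] (M : MDP S A H) {n : ℕ} (gr : QFun S A H → Policy S A)
    (f : QFun S A H) (h : Fin H) (D : Data S A H n) : ℝ :=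
  (1 / (n : ℝ)) * ∑ i,
    (if (D i h).2.1 = (gr f).act h (D i h).1 then 1 else 0) / (1 / (Fintype.card A : ℝ)) *
      M.tdError f h (D i h)

/-- Follow `π`, except that the action of step `t` is uniformly random. -/
def explore [Fintype A] [Nonempty A] (π : Policy S A) (t : ℕ) : ℕ → Kernel S A :=
  Function.update π.kernel t (Kernel.const S (PMF.uniformOfFintype A).toMeasure)

/-- State of a run: either it has not terminated yet, or it has terminated with an output
policy after a total number of executed episodes. -/
inductive Outcome (S : Type u) (A : Type v) [MeasurableSpace S] [MeasurableSpace A] where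
  | running : Outcome S A
  | done (output : Policy S A) (episodes : ℕ) : Outcome S A

instance : MeasurableSpace (Outcome S A) := ⊤

/-- The choices which the pseudocode leaves open: the maximizer `f^k` over the current version
space, and the step `t` at which the elimination takes place. They may depend on the phase, on the
current version space and, for `t`, on the data collected in the current phase. -/
structure Choices (S : Type u) (A : Type v) (H n : ℕ) where
  optimist : ℕ → Set (QFun S A H) → QFun S A H
  pick : ℕ → Set (QFun S A H) → Data S A H n → Fin H

/-- The choices respect the pseudocode: `f^k` maximizes `f_1(s_1, π_f(s_1))` over the version space,
and the estimated Bellman error at the picked step exceeds `ζ_act` as soon as there is such a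
step. -/
structure Choices.Valid (M : MDP S A H) (gr : QFun S A H → Policy S A) (F : Set (QFun S A H))
    (p : Params) (ch : Choices S A H p.nAct) : Prop where
  optimist_mem : ∀ k B, B ⊆ F → B.Nonempty → ch.optimist k B ∈ B
  optimist_max : ∀ k B, B ⊆ F → B.Nonempty → ∀ g ∈ B,
    g.at 0 M.init ((gr g).act 0 M.init) ≤
      (ch.optimist k B).at 0 M.init ((gr (ch.optimist k B)).act 0 M.init)
  measurable_pick : ∀ k B, B ⊆ F → B.Nonempty → Measurable (ch.pick k B)
  pick_spec : ∀ k B, B ⊆ F → B.Nonempty → ∀ D : Data S A H p.nAct,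
    (∃ t, p.zetaAct < M.actEstimate (ch.optimist k B) t D) →
      p.zetaAct < M.actEstimate (ch.optimist k B) (ch.pick k B D) D

/-- Law of the state of V-type OLIVE after at most `N` further phases, when it is about to start
phase `k` with version space `B`, having used `m` episodes so far. -/
def MDP.oliveLaw [Fintype A] [Nonempty A] (M : MDP S A H) (gr : QFun S A H → Policy S A)
    (p : Params) (ch : Choices S A H p.nAct) :
    (N : ℕ) → (k : ℕ) → (B : Set (QFun S A H)) → (m : ℕ) → Measure (Outcome S A)
  | 0, _, _, _ => Measure.dirac Outcome.running
  | N + 1, k, B, m =>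
      let f := ch.optimist k B
      let π := gr f
      (M.dataLaw π.kernel p.nAct).bind fun D =>
        if ∑ h, M.actEstimate f h D ≤ H * p.zetaAct then
          Measure.dirac (Outcome.done π (m + p.nAct))
        else
          let t := ch.pick k B D
          (M.dataLaw (explore π t) p.nElim).bind fun D' =>
            MDP.oliveLaw M gr p ch N (k + 1)
              {g ∈ B | |M.elimEstimate gr g t D'| ≤ p.zetaElim} (m + p.nAct + p.nElim)

/-- Probability that V-type OLIVE, started with version space `F`, terminates with an output
policy and a total number of episodes that satisfy `E`. (The events "terminated within `N` phases
with such an outcome" increase with `N`.) -/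
def MDP.oliveProb [Fintype A] [Nonempty A] (M : MDP S A H) (gr : QFun S A H → Policy S A)
    (F : Set (QFun S A H)) (p : Params) (ch : Choices S A H p.nAct)
    (E : Policy S A → ℕ → Prop) : ENNReal :=
  ⨆ N : ℕ, M.oliveLaw gr p ch N 1 F 0 {o | ∃ π n, o = Outcome.done π n ∧ E π n}

/-- `ι = c log (H d |A| / (δ ε))`, with `nA` the number of actions. -/
def iota (c : ℝ) (H d nA : ℕ) (δ ε : ℝ) : ℝ :=
  c * Real.log ((H : ℝ) * d * nA / (δ * ε))

/-- The choice of parameters, with sample sizes rounded up; `nA` is the number of actions and `nF`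
the cardinality of the function class. -/
def oliveParams (c : ℝ) (H d nA nF : ℕ) (δ ε : ℝ) : Params where
  zetaAct := 2 * ε / H
  zetaElim := ε / (2 * H * Real.sqrt d)
  nAct := ⌈(H : ℝ) ^ 2 * iota c H d nA δ ε / ε ^ 2⌉₊
  nElim := ⌈(H : ℝ) ^ 2 * d * nA * Real.log nF * iota c H d nA δ ε / ε ^ 2⌉₊

end VOlive

end

open VOlive

/-! ### Concentration of empirical means -/

namespace VOlive

/-! The argument is optimism combined with a potential argument over phases.

Realizability and the greedy selector provide a measurable policy greedy for `Q^⋆`; backward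
induction shows that it is optimal, so `Q^⋆` has zero Bellman residual (`MDP.vResidual_qStar`). On
the concentration events `Q^⋆` is therefore never eliminated, and the value which `f^k` predicts at
the initial state is at least `V^⋆`. The predicted value exceeds the true value of `π^k` by exactly
the sum over steps of the mean on-policy residuals (`MDP.at_sub_value_eq_sum`). If the run
terminates, this sum is at most `3ε`, and `π^k` is `3ε`-optimal.

If it does not terminate, the mean residual of `f^k` at the picked step `t` exceeds `ε/H`. Since
`f^k` survived all earlier eliminations at `t`, its residuals under the roll-ins used there are at
most `2 ζ_elim = ε/(H√d)`. There are at most `d` of these, so their Euclidean norm is at most `ε/H`: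
the new roll-in is independent of the old ones (`MDP.HasHistory.snoc`). Each step thus triggers at
most `d` eliminations, and the run ends within `H d + 1` phases (`MDP.le_oliveLaw`).

Data are fresh in every phase, so concentration is needed only for a fixed `f^k`. Activation needs a
union bound over steps, elimination one over the class. The importance-weighted estimate has second
moment `O(|A|)` although its range is also of order `|A|`; a Bernstein bound keeps the sample size
linear in `|A|`. -/

lemma mgf_le_of_abs_le {Ω : Type*} [MeasurableSpace Ω] {μ : Measure Ω} [IsProbabilityMeasure μ]
    {X : Ω → ℝ} {b v l : ℝ} (hX : Measurable X) (hb : ∀ ω, |X ω| ≤ b)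
    (hv : ∫ ω, X ω ^ 2 ∂μ ≤ v) (hl : 0 ≤ l) (hlb : l * b ≤ 1) :
    mgf X μ l ≤ Real.exp (l * ∫ ω, X ω ∂μ + l ^ 2 * v) := by
  have hXi : Integrable X μ := .of_bound hX.aestronglyMeasurable b (.of_forall hb)
  have hX2 : Integrable (fun ω => X ω ^ 2) μ := by
    refine .of_bound (hX.pow_const 2).aestronglyMeasurable (b ^ 2) (.of_forall fun ω => ?_)
    rw [Real.norm_eq_abs, abs_pow]
    exact pow_le_pow_left₀ (abs_nonneg _) (hb ω) 2
  have hsmall : ∀ ω, |l * X ω| ≤ 1 := fun ω => by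
    rw [abs_mul, abs_of_nonneg hl]
    exact (mul_le_mul_of_nonneg_left (hb ω) hl).trans hlb
  have hexp : Integrable (fun ω => Real.exp (l * X ω)) μ := by
    refine .of_bound (by fun_prop) (Real.exp 1) (.of_forall fun ω => ?_)
    rw [Real.norm_eq_abs, Real.abs_exp]
    exact Real.exp_le_exp.2 ((le_abs_self _).trans (hsmall ω))
  have hlin : Integrable (fun ω => 1 + l * X ω) μ := (integrable_const 1).add (hXi.const_mul l)
  have hquad : Integrable (fun ω => 1 + l * X ω + l ^ 2 * X ω ^ 2) μ :=
    hlin.add (hX2.const_mul (l ^ 2))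
  calc mgf X μ l ≤ ∫ ω, (1 + l * X ω + l ^ 2 * X ω ^ 2) ∂μ := by
        refine integral_mono hexp hquad fun ω => ?_
        -- `exp x ≤ 1 + x + x²` for `|x| ≤ 1`; the quadratic term retains the second moment, which
        -- Hoeffding's bound would replace by `b²`.
        have := (abs_le.1 (Real.abs_exp_sub_one_sub_id_le (hsmall ω))).2
        simp only
        nlinarith
    _ = 1 + l * ∫ ω, X ω ∂μ + l ^ 2 * ∫ ω, X ω ^ 2 ∂μ := by
        rw [integral_add hlin (hX2.const_mul _),
          integral_add (integrable_const 1) (hXi.const_mul l), integral_const_mul,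
          integral_const_mul]
        simp
    _ ≤ 1 + (l * ∫ ω, X ω ∂μ + l ^ 2 * v) := by
        have := mul_le_mul_of_nonneg_left hv (sq_nonneg l)
        linarith
    _ ≤ _ := by
        rw [add_comm]
        exact Real.add_one_le_exp _

/-- A one-sided Bernstein inequality for the empirical mean. -/
lemma measureReal_mean_ge_le {Ω : Type*} [MeasurableSpace Ω] {μ : Measure Ω}
    [IsProbabilityMeasure μ] {X : Ω → ℝ} {b v t : ℝ} {n : ℕ} (hX : Measurable X)
    (hb : ∀ ω, |X ω| ≤ b) (hv : ∫ ω, X ω ^ 2 ∂μ ≤ v) (hv0 : 0 < v) (ht : 0 ≤ t)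
    (htb : t * b ≤ 2 * v) (hn : 0 < n) :
    (Measure.pi (fun _ : Fin n => μ)).real
        {D | t ≤ (1 / (n : ℝ)) * ∑ i, X (D i) - ∫ ω, X ω ∂μ} ≤
      Real.exp (-(n * t ^ 2 / (4 * v))) := by
  -- The minimizer of the Chernoff exponent `-l t + l² v`, with value `-t²/(4v)`; `htb` is exactly
  -- what makes it admissible, `l b ≤ 1`.
  set l := t / (2 * v) with hl
  have hl0 : 0 ≤ l := by positivity
  have hlb : l * b ≤ 1 := by
    rw [hl, div_mul_eq_mul_div, div_le_one (by positivity)]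
    exact htb
  set m := ∫ ω, X ω ∂μ with hm
  set ν := Measure.pi (fun _ : Fin n => μ) with hν
  have hn' : (0 : ℝ) < n := by exact_mod_cast hn
  have hind : iIndepFun (fun (i : Fin n) (D : Fin n → Ω) => X (D i)) ν :=
    iIndepFun_pi (fun _ => hX.aemeasurable)
  have hmeas : ∀ i : Fin n, Measurable (fun D : Fin n → Ω => X (D i)) :=
    fun i => hX.comp (measurable_pi_apply i)
  have hmgf : mgf (∑ i : Fin n, fun D : Fin n → Ω => X (D i)) ν l =
      ∏ _i : Fin n, mgf X μ l := by
    rw [hind.mgf_sum hmeas]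
    refine Finset.prod_congr rfl fun i _ => ?_
    have hmp := measurePreserving_eval (fun _ : Fin n => μ) i
    have := mgf_map (μ := ν) (Y := fun D : Fin n → Ω => D i) (X := X) (t := l)
      (measurable_pi_apply i).aemeasurable
      (by exact (Measurable.aestronglyMeasurable (by fun_prop)))
    rw [show Measure.map (fun D : Fin n → Ω => D i) ν = μ from hmp.map_eq] at this
    rw [this]
    rfl
  have hbd : ∀ D : Fin n → Ω, |∑ i, X (D i)| ≤ n * b := fun D => by
    refine (Finset.abs_sum_le_sum_abs _ _).trans ?_
    refine (Finset.sum_le_sum fun i _ => hb (D i)).trans ?_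
    simp
  have hint : Integrable
      (fun D => Real.exp (l * (∑ i : Fin n, fun D : Fin n → Ω => X (D i)) D)) ν := by
    simp only [Finset.sum_apply]
    refine .of_bound (Measurable.aestronglyMeasurable (by fun_prop)) (Real.exp (l * (n * b)))
      (.of_forall fun D => ?_)
    rw [Real.norm_eq_abs, Real.abs_exp]
    exact Real.exp_le_exp.2 (mul_le_mul_of_nonneg_left ((le_abs_self _).trans (hbd D)) hl0)
  have hset : {D : Fin n → Ω | t ≤ (1 / (n : ℝ)) * ∑ i, X (D i) - m} =
      {D | n * (t + m) ≤ (∑ i : Fin n, fun D : Fin n → Ω => X (D i)) D} := by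
    ext D
    simp only [Set.mem_ofPred_eq, Finset.sum_apply]
    rw [le_sub_iff_add_le, one_div, inv_mul_eq_div, le_div_iff₀ hn', mul_comm]
  rw [hset]
  refine (measure_ge_le_exp_mul_mgf _ hl0 hint).trans ?_
  rw [hmgf, Finset.prod_const, Finset.card_univ, Fintype.card_fin]
  calc Real.exp (-l * (n * (t + m))) * mgf X μ l ^ n
      ≤ Real.exp (-l * (n * (t + m))) * Real.exp (l * m + l ^ 2 * v) ^ n := by
        gcongr
        · exact mgf_nonneg
        · exact mgf_le_of_abs_le hX hb hv hl0 hlb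
    _ = Real.exp (-(n * t ^ 2 / (4 * v))) := by
        rw [← Real.exp_nat_mul, ← Real.exp_add]
        congr 1
        rw [hl]
        field_simp
        ring

/-- A Bernstein inequality for the empirical mean. -/
lemma measure_mean_deviation_le {Ω : Type*} [MeasurableSpace Ω] {μ : Measure Ω}
    [IsProbabilityMeasure μ] {X : Ω → ℝ} {b v t : ℝ} {n : ℕ} (hX : Measurable X)
    (hb : ∀ ω, |X ω| ≤ b) (hv : ∫ ω, X ω ^ 2 ∂μ ≤ v) (hv0 : 0 < v) (ht : 0 ≤ t)
    (htb : t * b ≤ 2 * v) (hn : 0 < n) :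
    Measure.pi (fun _ : Fin n => μ) {D | t < |(1 / (n : ℝ)) * ∑ i, X (D i) - ∫ ω, X ω ∂μ|} ≤
      ENNReal.ofReal (2 * Real.exp (-(n * t ^ 2 / (4 * v)))) := by
  have h1 := measureReal_mean_ge_le hX hb hv hv0 ht htb hn
  have h2 := measureReal_mean_ge_le (X := fun ω => -X ω) (μ := μ) hX.neg
    (by simpa using hb) (by simpa using hv) hv0 ht htb hn
  have hsub : {D : Fin n → Ω | t < |(1 / (n : ℝ)) * ∑ i, X (D i) - ∫ ω, X ω ∂μ|} ⊆
      {D | t ≤ (1 / (n : ℝ)) * ∑ i, X (D i) - ∫ ω, X ω ∂μ} ∪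
        {D | t ≤ (1 / (n : ℝ)) * ∑ i, -X (D i) - ∫ ω, -X ω ∂μ} := by
    intro D hD
    simp only [Set.mem_ofPred_eq, Set.mem_union] at hD ⊢
    rw [integral_neg, Finset.sum_neg_distrib]
    rcases lt_abs.1 hD with h | h
    · exact Or.inl h.le
    · right
      linarith
  refine (measure_mono hsub).trans ((measure_union_le _ _).trans ?_)
  rw [two_mul, ENNReal.ofReal_add (Real.exp_nonneg _) (Real.exp_nonneg _)]
  refine add_le_add ?_ ?_
  · rw [← ofReal_measureReal]
    exact ENNReal.ofReal_le_ofReal h1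
  · rw [← ofReal_measureReal]
    exact ENNReal.ofReal_le_ofReal h2

/-- Lower bound for an average over a random variable with a good event of high probability. -/
lemma ofReal_sub_le_lintegral {Ω : Type*} [MeasurableSpace Ω] {μ : Measure Ω}
    [IsProbabilityMeasure μ] {f : Ω → ENNReal} {Bad : Set Ω} {x y : ℝ} (hx : 0 ≤ x) (hy : 0 ≤ y)
    (hBad : μ Bad ≤ ENNReal.ofReal y) (hf : ∀ ω, ω ∉ Bad → ENNReal.ofReal (1 - x) ≤ f ω) :
    ENNReal.ofReal (1 - (x + y)) ≤ ∫⁻ ω, f ω ∂μ := by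
  -- The bad event need not be measurable, so its measurable hull is removed instead.
  set T := toMeasurable μ Bad with hT
  have hTm : MeasurableSet T := measurableSet_toMeasurable μ Bad
  rcases lt_or_ge (1 - x) 0 with h | h
  · rw [ENNReal.ofReal_of_nonpos (by linarith)]
    exact zero_le
  have hTc : ENNReal.ofReal (1 - y) ≤ μ Tᶜ := by
    rw [prob_compl_eq_one_sub hTm, measure_toMeasurable, ENNReal.ofReal_sub _ hy,
      ENNReal.ofReal_one]
    exact tsub_le_tsub_left hBad 1
  calc ENNReal.ofReal (1 - (x + y)) ≤ ENNReal.ofReal ((1 - x) * (1 - y)) :=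
        ENNReal.ofReal_le_ofReal (by nlinarith)
    _ = ENNReal.ofReal (1 - x) * ENNReal.ofReal (1 - y) := ENNReal.ofReal_mul h
    _ ≤ ENNReal.ofReal (1 - x) * μ Tᶜ := by gcongr
    _ = ∫⁻ _ in Tᶜ, ENNReal.ofReal (1 - x) ∂μ := by simp
    _ ≤ ∫⁻ ω in Tᶜ, f ω ∂μ := by
        refine setLIntegral_mono' hTm.compl fun ω hω => hf ω fun hb => hω ?_
        exact subset_toMeasurable μ Bad hb
    _ ≤ ∫⁻ ω, f ω ∂μ := setLIntegral_le_lintegral _ _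

end VOlive

/-! ### Laws of trajectories and their one-step marginals -/

namespace VOlive

variable {S : Type u} {A : Type v} [MeasurableSpace S] [MeasurableSpace A] {H : ℕ}

instance (π : Policy S A) (h : ℕ) : IsMarkovKernel (π.kernel h) := by
  unfold Policy.kernel; infer_instance

instance (M : MDP S A H) (h : ℕ) : IsMarkovKernel (M.P h) := M.markov h

instance (M : MDP S A H) (κ : ℕ → Kernel S A) [∀ h, IsMarkovKernel (κ h)] (h : ℕ) :
    IsMarkovKernel (M.stepLaw κ h) := by
  unfold MDP.stepLaw; infer_instance

lemma measurable_fin_cons {n : ℕ} {X : Type*} [MeasurableSpace X] :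
    Measurable (fun q : X × (Fin n → X) => (Fin.cons q.1 q.2 : Fin (n + 1) → X)) := by
  refine measurable_pi_lambda _ fun i => ?_
  refine Fin.cases ?_ (fun j => ?_) i
  · simpa using measurable_fst
  · simp only [Fin.cons_succ]
    fun_prop

instance trajLaw.isMarkovKernel (M : MDP S A H) (κ : ℕ → Kernel S A)
    [hκ : ∀ h, IsMarkovKernel (κ h)] (n h : ℕ) : IsMarkovKernel (M.trajLaw κ n h) := by
  induction n generalizing h with
  | zero =>
    unfold MDP.trajLaw
    infer_instance
  | succ n ih =>
    have := ih (h + 1)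
    unfold MDP.trajLaw
    exact Kernel.IsMarkovKernel.map _ measurable_fin_cons

instance (M : MDP S A H) (κ : ℕ → Kernel S A) [∀ h, IsMarkovKernel (κ h)] :
    IsProbabilityMeasure (M.episodeLaw κ) := by
  unfold MDP.episodeLaw; infer_instance

/-- Integration against the law of one step. -/
lemma MDP.integral_stepLaw (M : MDP S A H) (κ : ℕ → Kernel S A) [∀ h, IsMarkovKernel (κ h)]
    (h : ℕ) (s : S) {φ : Tuple S A → ℝ} {b : ℝ} (hφ : Measurable φ) (hb : ∀ z, |φ z| ≤ b) :
    ∫ z, φ z ∂(M.stepLaw κ h s) =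
      ∫ a, ∫ s', φ (s, a, s') ∂(M.P h (s, a)) ∂(κ h s) := by
  unfold MDP.stepLaw
  rw [Kernel.prod_apply, Kernel.id_apply, Measure.dirac_prod,
    integral_map (by fun_prop) hφ.aestronglyMeasurable, integral_compProd]
  exact .of_bound (Measurable.aestronglyMeasurable (by fun_prop)) b (.of_forall fun z => hb _)

/-- The transition kernel of the state process under `κ`. -/
noncomputable def MDP.transKernel (M : MDP S A H) (κ : ℕ → Kernel S A) (h : ℕ) : Kernel S S :=
  (M.stepLaw κ h).map (fun z => z.2.2)

instance (M : MDP S A H) (κ : ℕ → Kernel S A) [∀ h, IsMarkovKernel (κ h)] (h : ℕ) :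
    IsMarkovKernel (M.transKernel κ h) := by
  unfold MDP.transKernel
  exact Kernel.IsMarkovKernel.map _ (by fun_prop)

/-- Law of the state `s_{h+i}` given `s_h`. -/
noncomputable def MDP.stateLaw (M : MDP S A H) (κ : ℕ → Kernel S A) : ℕ → ℕ → Kernel S S
  | 0, _ => Kernel.id
  | i + 1, h => (M.stateLaw κ i (h + 1)) ∘ₖ M.transKernel κ h

instance stateLaw.isMarkovKernel (M : MDP S A H) (κ : ℕ → Kernel S A)
    [∀ h, IsMarkovKernel (κ h)] (i h : ℕ) : IsMarkovKernel (M.stateLaw κ i h) := by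
  induction i generalizing h with
  | zero => unfold MDP.stateLaw; infer_instance
  | succ i ih =>
    have := ih (h + 1)
    unfold MDP.stateLaw
    infer_instance

/-- A state depends only on the actions taken strictly before it. Hence a random action at step `t`
does not change the law of `s_t`. -/
lemma MDP.stateLaw_congr (M : MDP S A H) {κ κ' : ℕ → Kernel S A} (i h : ℕ)
    (hκ : ∀ j, h ≤ j → j < h + i → κ j = κ' j) : M.stateLaw κ i h = M.stateLaw κ' i h := by
  induction i generalizing h with
  | zero => rfl
  | succ i ih =>
    simp only [MDP.stateLaw, MDP.transKernel, MDP.stepLaw]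
    rw [ih (h + 1) fun j h1 h2 => hκ j (by omega) (by omega), hκ h le_rfl (by omega)]

lemma MDP.trajLaw_congr (M : MDP S A H) {κ κ' : ℕ → Kernel S A} (n h : ℕ)
    (hκ : ∀ j, h ≤ j → κ j = κ' j) : M.trajLaw κ n h = M.trajLaw κ' n h := by
  induction n generalizing h with
  | zero => rfl
  | succ n ih =>
    simp only [MDP.trajLaw, MDP.stepLaw]
    rw [ih (h + 1) fun j h1 => hκ j (by omega), hκ h le_rfl]

lemma MDP.map_trajLaw_zero (M : MDP S A H) (κ : ℕ → Kernel S A) [∀ h, IsMarkovKernel (κ h)]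
    (n h : ℕ) : (M.trajLaw κ (n + 1) h).map (fun τ => τ 0) = M.stepLaw κ h := by
  unfold MDP.trajLaw
  rw [← Kernel.map_comp_right _ measurable_fin_cons (by fun_prop)]
  have : ((fun τ : Fin (n + 1) → Tuple S A => τ 0) ∘
      fun q : Tuple S A × (Fin n → Tuple S A) => (Fin.cons q.1 q.2 : Fin (n + 1) → Tuple S A))
      = Prod.fst := by
    ext q <;> simp
  rw [this, ← Kernel.fst_eq, Kernel.fst_compProd]

lemma MDP.map_trajLaw_tail (M : MDP S A H) (κ : ℕ → Kernel S A) [∀ h, IsMarkovKernel (κ h)]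
    (n h : ℕ) : (M.trajLaw κ (n + 1) h).map (fun τ (i : Fin n) => τ i.succ) =
      M.trajLaw κ n (h + 1) ∘ₖ M.transKernel κ h := by
  conv_lhs => unfold MDP.trajLaw
  rw [← Kernel.map_comp_right _ measurable_fin_cons (by fun_prop)]
  have : ((fun (τ : Fin (n + 1) → Tuple S A) (i : Fin n) => τ i.succ) ∘
      fun q : Tuple S A × (Fin n → Tuple S A) => (Fin.cons q.1 q.2 : Fin (n + 1) → Tuple S A))
      = Prod.snd := by
    ext q <;> simp
  rw [this, ← Kernel.snd_eq]
  ext s t ht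
  rw [Kernel.snd_apply' _ _ ht, Kernel.compProd_apply (measurable_snd ht), Kernel.comp_apply' _ _ _ ht,
    MDP.transKernel, Kernel.map_apply _ (by fun_prop), lintegral_map (Kernel.measurable_coe _ ht) (by fun_prop)]
  rfl

/-- Peeling off first steps reduces the `i`-th marginal to the first one. Rewards and residuals each
involve a single step, so this marginal is all that is needed of the trajectory law. -/
lemma MDP.map_trajLaw_eval (M : MDP S A H) (κ : ℕ → Kernel S A) [∀ h, IsMarkovKernel (κ h)]
    (n h : ℕ) (i : Fin n) : (M.trajLaw κ n h).map (fun τ => τ i) =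
      M.stepLaw κ (h + i) ∘ₖ M.stateLaw κ i h := by
  induction n generalizing h with
  | zero => exact i.elim0
  | succ n ih =>
    refine Fin.cases ?_ (fun j => ?_) i
    · rw [M.map_trajLaw_zero κ n h]
      simp [MDP.stateLaw]
    · have : (fun τ : Fin (n + 1) → Tuple S A => τ j.succ) =
          (fun τ => τ j) ∘ (fun τ (i : Fin n) => τ i.succ) := rfl
      rw [this, Kernel.map_comp_right _ (by fun_prop) (by fun_prop), M.map_trajLaw_tail,
        Kernel.map_comp, ih, Fin.val_succ, MDP.stateLaw, Kernel.comp_assoc,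
        show h + 1 + (j : ℕ) = h + (j + 1) by ring]

lemma MDP.map_episodeLaw_state (M : MDP S A H) (κ : ℕ → Kernel S A) [∀ h, IsMarkovKernel (κ h)]
    (h : Fin H) : (M.episodeLaw κ).map (fun τ => (τ h).1) = M.stateLaw κ h 0 M.init := by
  have h1 := M.map_trajLaw_eval κ H 0 h
  have h2 : (M.episodeLaw κ).map (fun τ => (τ h).1) =
      (((M.trajLaw κ H 0).map (fun τ => τ h)).map Prod.fst) M.init := by
    rw [← Kernel.map_comp_right _ (by fun_prop) (by fun_prop), Kernel.map_apply _ (by fun_prop)]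
    rfl
  have h3 : (M.stepLaw κ (0 + h)).map Prod.fst = Kernel.id := by
    rw [← Kernel.fst_eq, MDP.stepLaw, Kernel.fst_prod]
  rw [h2, h1, ← Kernel.fst_eq, Kernel.fst_comp, Kernel.fst_eq, h3, Kernel.id_comp]

lemma MDP.integral_trajLaw_eval (M : MDP S A H) (κ : ℕ → Kernel S A)
    [∀ h, IsMarkovKernel (κ h)] {n : ℕ} (h : ℕ) (i : Fin n) (s : S) {φ : Tuple S A → ℝ} {b : ℝ}
    (hφ : Measurable φ) (hb : ∀ z, |φ z| ≤ b) :
    ∫ τ, φ (τ i) ∂(M.trajLaw κ n h s) =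
      ∫ s', ∫ z, φ z ∂(M.stepLaw κ (h + i) s') ∂(M.stateLaw κ i h s) := by
  have h1 : (M.trajLaw κ n h s).map (fun τ => τ i) =
      (M.stepLaw κ (h + i) ∘ₖ M.stateLaw κ i h) s := by
    rw [← Kernel.map_apply _ (by fun_prop), M.map_trajLaw_eval]
  rw [← Kernel.integral_comp, ← h1,
    integral_map (measurable_pi_apply i).aemeasurable hφ.aestronglyMeasurable]
  exact .of_bound hφ.aestronglyMeasurable b (.of_forall hb)

end VOlive

/-! ### Value functions and the Bellman optimality equation -/

namespace VOlive

variable {S : Type u} {A : Type v} [MeasurableSpace S] [MeasurableSpace A] {H : ℕ}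

section Kernels

variable {X Y : Type*} [MeasurableSpace X] [MeasurableSpace Y]

lemma measurable_integral_kernel (κ : Kernel X Y) {φ : Y → ℝ}
    (hφ : Measurable φ) : Measurable fun x => ∫ y, φ y ∂(κ x) :=
  hφ.stronglyMeasurable.integral_kernel.measurable

lemma abs_integral_le_of_abs_le {μ : Measure X} [IsProbabilityMeasure μ] {φ : X → ℝ} {b : ℝ}
    (hb : ∀ x, |φ x| ≤ b) : |∫ x, φ x ∂μ| ≤ b := by
  have := norm_integral_le_of_norm_le_const (μ := μ) (f := φ) (C := b)
    (.of_forall fun x => by simpa using hb x)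
  simpa using this

lemma integrable_of_abs_le {μ : Measure X} [IsFiniteMeasure μ] {φ : X → ℝ} {b : ℝ}
    (hφ : Measurable φ) (hb : ∀ x, |φ x| ≤ b) : Integrable φ μ :=
  .of_bound hφ.aestronglyMeasurable b (.of_forall hb)

end Kernels

namespace MDP

lemma r_le_one (M : MDP S A H) {h : ℕ} (hh : h < H) (s : S) (a : A) : M.r h s a ≤ 1 := by
  refine le_trans ?_ (M.r_sum_le_one (fun _ => s) (fun _ => a))
  exact Finset.single_le_sum (f := fun i => M.r i s a) (fun i _ => M.r_nonneg i s a)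
    (Finset.mem_range.2 hh)

lemma abs_r_le_one (M : MDP S A H) {h : ℕ} (hh : h < H) (s : S) (a : A) : |M.r h s a| ≤ 1 := by
  rw [abs_of_nonneg (M.r_nonneg h s a)]
  exact M.r_le_one hh s a

lemma measurable_r_tuple (M : MDP S A H) (h : ℕ) :
    Measurable (fun z : Tuple S A => M.r h z.1 z.2.1) :=
  (M.measurable_r h).comp (f := fun z : Tuple S A => (z.1, z.2.1)) (by fun_prop)

/-- Expected reward of step `h` from the state `s`. -/
noncomputable def stepReward (M : MDP S A H) (κ : ℕ → Kernel S A) (h : ℕ) (s : S) : ℝ :=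
  ∫ z, M.r h z.1 z.2.1 ∂(M.stepLaw κ h s)

lemma measurable_stepReward (M : MDP S A H) (κ : ℕ → Kernel S A) (h : ℕ) :
    Measurable (M.stepReward κ h) :=
  measurable_integral_kernel _ (M.measurable_r_tuple h)

lemma abs_stepReward_le (M : MDP S A H) (κ : ℕ → Kernel S A) [∀ h, IsMarkovKernel (κ h)]
    {h : ℕ} (hh : h < H) (s : S) : |M.stepReward κ h s| ≤ 1 :=
  abs_integral_le_of_abs_le fun _ => M.abs_r_le_one hh _ _

lemma expReward_eq_sum (M : MDP S A H) (κ : ℕ → Kernel S A) [∀ h, IsMarkovKernel (κ h)]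
    (h : ℕ) (s : S) : M.expReward κ h s =
      ∑ i ∈ Finset.range (H - h), ∫ s', M.stepReward κ (h + i) s' ∂(M.stateLaw κ i h s) := by
  unfold expReward
  have hb : ∀ i : Fin (H - h), ∀ z : Tuple S A, |M.r (h + i) z.1 z.2.1| ≤ 1 := fun i z =>
    M.abs_r_le_one (by omega) _ _
  have hi : ∀ i : Fin (H - h), Integrable
      (fun τ : Fin (H - h) → Tuple S A => M.r (h + i) (τ i).1 (τ i).2.1)
      (M.trajLaw κ (H - h) h s) := fun i => integrable_of_abs_le
    ((M.measurable_r_tuple _).comp (measurable_pi_apply i)) fun τ => hb i (τ i)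
  rw [integral_finsetSum _ fun i _ => hi i,
    Finset.sum_range (n := H - h)]
  exact Finset.sum_congr rfl fun i _ =>
    M.integral_trajLaw_eval κ h i s (M.measurable_r_tuple _) (hb i)

lemma measurable_expReward (M : MDP S A H) (κ : ℕ → Kernel S A) [∀ h, IsMarkovKernel (κ h)]
    (h : ℕ) : Measurable (M.expReward κ h) := by
  rw [show M.expReward κ h = _ from funext (M.expReward_eq_sum κ h)]
  exact Finset.measurable_fun_sum _ fun i _ =>
    measurable_integral_kernel _ (M.measurable_stepReward κ _)

/-- A crude bound; it serves only integrability and the boundedness of the suprema over policies. -/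
lemma abs_expReward_le (M : MDP S A H) (κ : ℕ → Kernel S A) [∀ h, IsMarkovKernel (κ h)]
    (h : ℕ) (s : S) : |M.expReward κ h s| ≤ H := by
  rw [expReward_eq_sum]
  refine (Finset.abs_sum_le_sum_abs _ _).trans ?_
  refine (Finset.sum_le_sum (g := fun _ => (1 : ℝ)) fun i hi => ?_).trans ?_
  · have := Finset.mem_range.1 hi
    exact abs_integral_le_of_abs_le fun _ => M.abs_stepReward_le κ (by omega) _
  · simp

lemma expReward_of_le (M : MDP S A H) (κ : ℕ → Kernel S A) [∀ h, IsMarkovKernel (κ h)]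
    {h : ℕ} (hh : H ≤ h) (s : S) : M.expReward κ h s = 0 := by
  rw [expReward_eq_sum, Nat.sub_eq_zero_of_le hh]
  simp

lemma integral_stateLaw_succ (M : MDP S A H) (κ : ℕ → Kernel S A) [∀ h, IsMarkovKernel (κ h)]
    (i h : ℕ) (s : S) {φ : S → ℝ} {b : ℝ} (hφ : Measurable φ) (hb : ∀ s, |φ s| ≤ b) :
    ∫ s', φ s' ∂(M.stateLaw κ (i + 1) h s) =
      ∫ x, ∫ s', φ s' ∂(M.stateLaw κ i (h + 1) x) ∂(M.transKernel κ h s) := by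
  rw [← Kernel.integral_comp]
  · rfl
  · exact integrable_of_abs_le hφ hb

/-- The Markov property for additive functionals. It is applied to rewards, for the Bellman
equation, and to residuals, for the loss decomposition. -/
lemma sum_integral_stateLaw (M : MDP S A H) (κ : ℕ → Kernel S A) [∀ h, IsMarkovKernel (κ h)]
    {φ : ℕ → S → ℝ} {b : ℝ} (hφ : ∀ j, Measurable (φ j)) (hb : ∀ j < H, ∀ s, |φ j s| ≤ b)
    {h : ℕ} (hh : h < H) (s : S) :
    ∑ i ∈ Finset.range (H - h), ∫ s', φ (h + i) s' ∂(M.stateLaw κ i h s) =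
      φ h s + ∫ x, ∑ i ∈ Finset.range (H - (h + 1)),
        ∫ s', φ (h + 1 + i) s' ∂(M.stateLaw κ i (h + 1) x) ∂(M.transKernel κ h s) := by
  rw [show H - h = (H - (h + 1)) + 1 by omega, Finset.sum_range_succ', add_comm]
  congr 1
  · simp only [stateLaw, Kernel.id_apply, add_zero]
    exact integral_dirac' _ _ (hφ h).stronglyMeasurable
  · rw [integral_finsetSum]
    · refine Finset.sum_congr rfl fun i hi => ?_
      have := Finset.mem_range.1 hi
      rw [M.integral_stateLaw_succ κ i h s (hφ _) (hb _ (by omega)),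
        show h + (i + 1) = h + 1 + i by ring]
    · intro i hi
      have := Finset.mem_range.1 hi
      exact integrable_of_abs_le (measurable_integral_kernel _ (hφ _))
        fun x => abs_integral_le_of_abs_le (hb _ (by omega))

lemma expReward_eq_add (M : MDP S A H) (κ : ℕ → Kernel S A) [∀ h, IsMarkovKernel (κ h)]
    {h : ℕ} (hh : h < H) (s : S) : M.expReward κ h s =
      M.stepReward κ h s + ∫ x, M.expReward κ (h + 1) x ∂(M.transKernel κ h s) := by
  simp only [expReward_eq_sum]
  exact M.sum_integral_stateLaw κ (M.measurable_stepReward κ)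
    (fun j hj => M.abs_stepReward_le κ hj) hh s

/-- One-step integrals for a deterministic choice of the action in the state `s`. -/
lemma integral_stepLaw_dirac (M : MDP S A H) (κ : ℕ → Kernel S A) [∀ h, IsMarkovKernel (κ h)]
    (h : ℕ) (s : S) (a : A) (ha : κ h s = Measure.dirac a) {φ : Tuple S A → ℝ} {b : ℝ}
    (hφ : Measurable φ) (hb : ∀ z, |φ z| ≤ b) :
    ∫ z, φ z ∂(M.stepLaw κ h s) = ∫ s', φ (s, a, s') ∂(M.P h (s, a)) := by
  rw [M.integral_stepLaw κ h s hφ hb, ha, integral_dirac']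
  have : Measurable fun q : A × S => φ (s, q.1, q.2) := by fun_prop
  have h2 : StronglyMeasurable fun a => ∫ s', (fun q : A × S => φ (s, q.1, q.2)) (a, s')
      ∂((M.P h).comap (fun a => (s, a)) (by fun_prop)) a :=
    this.stronglyMeasurable.integral_kernel_prod_right'
  exact h2

lemma integral_transKernel_dirac (M : MDP S A H) (κ : ℕ → Kernel S A) [∀ h, IsMarkovKernel (κ h)]
    (h : ℕ) (s : S) (a : A) (ha : κ h s = Measure.dirac a) {φ : S → ℝ} {b : ℝ}
    (hφ : Measurable φ) (hb : ∀ x, |φ x| ≤ b) :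
    ∫ x, φ x ∂(M.transKernel κ h s) = ∫ x, φ x ∂(M.P h (s, a)) := by
  rw [transKernel, Kernel.map_apply _ (by fun_prop),
    integral_map (by fun_prop) hφ.aestronglyMeasurable,
    M.integral_stepLaw_dirac κ h s a ha (φ := fun z => φ z.2.2) (by fun_prop) fun _ => hb _]

lemma expReward_of_dirac (M : MDP S A H) (κ : ℕ → Kernel S A) [∀ h, IsMarkovKernel (κ h)]
    {h : ℕ} (hh : h < H) (s : S) (a : A) (ha : κ h s = Measure.dirac a) :
    M.expReward κ h s = M.r h s a + ∫ x, M.expReward κ (h + 1) x ∂(M.P h (s, a)) := by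
  rw [M.expReward_eq_add κ hh, stepReward,
    M.integral_stepLaw_dirac κ h s a ha (M.measurable_r_tuple h) fun _ => M.abs_r_le_one hh _ _,
    M.integral_transKernel_dirac κ h s a ha (M.measurable_expReward κ _)
      (M.abs_expReward_le κ _)]
  simp

lemma policy_kernel_apply (π : Policy S A) (h : ℕ) (s : S) :
    π.kernel h s = Measure.dirac (π.act h s) := by
  unfold Policy.kernel
  rw [Kernel.deterministic_apply]

lemma measurable_value (M : MDP S A H) (π : Policy S A) (h : ℕ) : Measurable (M.value π h) :=
  M.measurable_expReward _ h

lemma abs_value_le (M : MDP S A H) (π : Policy S A) (h : ℕ) (s : S) : |M.value π h s| ≤ H :=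
  M.abs_expReward_le _ h s

lemma value_of_le (M : MDP S A H) (π : Policy S A) {h : ℕ} (hh : H ≤ h) (s : S) :
    M.value π h s = 0 :=
  M.expReward_of_le _ hh s

lemma value_eq (M : MDP S A H) (π : Policy S A) {h : ℕ} (hh : h < H) (s : S) :
    M.value π h s = M.r h s (π.act h s) +
      ∫ x, M.value π (h + 1) x ∂(M.P h (s, π.act h s)) :=
  M.expReward_of_dirac _ hh s _ (policy_kernel_apply π h s)

instance (κ : ℕ → Kernel S A) [∀ h, IsMarkovKernel (κ h)] (t : ℕ) (η : Kernel S A)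
    [IsMarkovKernel η] (h : ℕ) : IsMarkovKernel (Function.update κ t η h) := by
  by_cases hh : h = t
  · subst hh
    simpa
  · rw [Function.update_of_ne hh]
    infer_instance

lemma qValue_eq (M : MDP S A H) (π : Policy S A) {h : ℕ} (hh : h < H) (s : S) (a : A) :
    M.qValue π h s a = M.r h s a + ∫ x, M.value π (h + 1) x ∂(M.P h (s, a)) := by
  unfold qValue
  rw [M.expReward_of_dirac _ hh s a (by simp)]
  congr 1
  refine integral_congr_ae (.of_forall fun x => ?_)
  simp only [value, expReward]
  -- The modification at step `h` is invisible from step `h + 1` on.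
  rw [M.trajLaw_congr (H - (h + 1)) (h + 1) fun j hj => Function.update_of_ne (show j ≠ h by omega) _ _]

lemma abs_qValue_le (M : MDP S A H) (π : Policy S A) (h : ℕ) (s : S) (a : A) :
    |M.qValue π h s a| ≤ H :=
  M.abs_expReward_le _ h s

lemma value_eq_qValue (M : MDP S A H) (π : Policy S A) {h : ℕ} (hh : h < H) (s : S) :
    M.value π h s = M.qValue π h s (π.act h s) := by
  rw [M.value_eq π hh, M.qValue_eq π hh]

lemma qValue_le_qStar (M : MDP S A H) (π : Policy S A) (h : ℕ) (s : S) (a : A) :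
    M.qValue π h s a ≤ M.qStar h s a := by
  refine le_ciSup (f := fun π => M.qValue π h s a) ⟨H, ?_⟩ π
  rintro _ ⟨π', rfl⟩
  exact (abs_le.1 (M.abs_qValue_le π' h s a)).2

/-- A policy which is greedy for `Q^⋆` dominates all policies from every state. -/
lemma value_le_of_greedy_qStar (M : MDP S A H) {πs : Policy S A}
    (hg : ∀ (h : Fin H) s a, M.qStar h s a ≤ M.qStar h s (πs.act h s))
    (n h : ℕ) (hn : H ≤ h + n) (π : Policy S A) (s : S) : M.value π h s ≤ M.value πs h s := by
  induction n generalizing h π s with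
  | zero => rw [M.value_of_le π (by omega), M.value_of_le πs (by omega)]
  | succ n ih =>
    rcases le_or_gt H h with hh | hh
    · rw [M.value_of_le π hh, M.value_of_le πs hh]
    have hq : ∀ (π' : Policy S A) a, M.qValue π' h s a ≤ M.qValue πs h s a := fun π' a => by
      rw [M.qValue_eq π' hh, M.qValue_eq πs hh]
      gcongr
      · exact integrable_of_abs_le (M.measurable_value _ _) (M.abs_value_le _ _)
      · exact integrable_of_abs_le (M.measurable_value _ _) (M.abs_value_le _ _)
      · exact fun x => ih (h + 1) (by omega) π' x
    have : Nonempty (Policy S A) := ⟨πs⟩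
    -- The supremum in `Q^⋆` ranges over all policies, but by induction each continuation is
    -- dominated by that of `πs`, so after one action `πs` attains it. No optimal policy has to be
    -- constructed by measurable selection.
    calc M.value π h s = M.qValue π h s (π.act h s) := M.value_eq_qValue π hh s
      _ ≤ M.qStar h s (π.act h s) := M.qValue_le_qStar π h s _
      _ ≤ M.qStar h s (πs.act h s) := hg ⟨h, hh⟩ s _
      _ ≤ M.qValue πs h s (πs.act h s) := ciSup_le fun π' => hq π' _
      _ = M.value πs h s := (M.value_eq_qValue πs hh s).symm

lemma qStar_eq_qValue (M : MDP S A H) {πs : Policy S A}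
    (hg : ∀ (h : Fin H) s a, M.qStar h s a ≤ M.qStar h s (πs.act h s))
    {h : ℕ} (hh : h < H) (s : S) (a : A) : M.qStar h s a = M.qValue πs h s a := by
  have : Nonempty (Policy S A) := ⟨πs⟩
  refine le_antisymm (ciSup_le fun π => ?_) (M.qValue_le_qStar πs h s a)
  rw [M.qValue_eq π hh, M.qValue_eq πs hh]
  gcongr
  · exact integrable_of_abs_le (M.measurable_value _ _) (M.abs_value_le _ _)
  · exact integrable_of_abs_le (M.measurable_value _ _) (M.abs_value_le _ _)
  · exact fun x => M.value_le_of_greedy_qStar hg H (h + 1) (by omega) π x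

end MDP

lemma QFun.at_of_lt {X : Type u} {Y : Type v} (f : QFun X Y H) {h : ℕ} (hh : h < H) : f.at h = f ⟨h, hh⟩ := dif_pos hh

lemma QFun.at_of_le {X : Type u} {Y : Type v} (f : QFun X Y H) {h : ℕ} (hh : H ≤ h) : f.at h = 0 := dif_neg (by omega)

lemma IsGreedy.at_le {f : QFun S A H} {π : Policy S A} (hg : IsGreedy f π) (h : ℕ) (s : S)
    (a : A) : f.at h s a ≤ f.at h s (π.act h s) := by
  rcases lt_or_ge h H with hh | hh
  · rw [f.at_of_lt hh]
    exact hg ⟨h, hh⟩ s a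
  · simp [f.at_of_le hh]

lemma IsGreedy.iSup_eq [Finite A] {f : QFun S A H} {π : Policy S A} (hg : IsGreedy f π)
    (h : ℕ) (s : S) : ⨆ a, f.at h s a = f.at h s (π.act h s) := by
  have : Nonempty A := ⟨π.act h s⟩
  exact le_antisymm (ciSup_le fun a => hg.at_le h s a)
    (le_ciSup (f := fun a => f.at h s a) (Set.finite_range _).bddAbove _)

namespace MDP

/-- Bellman optimality equation. -/
lemma vResidual_qStar [Finite A] (M : MDP S A H) (gr : QFun S A H → Policy S A)
    (hg : IsGreedy (fun h : Fin H => M.qStar h) (gr fun h => M.qStar h)) (h : Fin H) (s : S) :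
    M.vResidual gr (fun h => M.qStar h) h s = 0 := by
  set qs : QFun S A H := fun h => M.qStar h with hqs
  have key : ∀ x, ⨆ a', qs.at (h + 1) x a' = M.value (gr qs) (h + 1) x := fun x => by
    rw [hg.iSup_eq]
    rcases lt_or_ge ((h : ℕ) + 1) H with hh | hh
    · rw [qs.at_of_lt hh, M.value_eq_qValue _ hh]
      exact M.qStar_eq_qValue hg hh _ _
    · rw [qs.at_of_le hh, M.value_of_le _ hh]
      rfl
  unfold vResidual bellman
  simp only [key]
  rw [← M.qValue_eq _ h.2, sub_eq_zero]
  exact M.qStar_eq_qValue hg h.2 _ _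

/-- The source of optimism: a maximizer over a version space containing `Q^⋆` predicts at least this
value. -/
lemma valueStar_le (M : MDP S A H) (gr : QFun S A H → Policy S A)
    (hg : IsGreedy (fun h : Fin H => M.qStar h) (gr fun h => M.qStar h)) (s : S) :
    M.valueStar 0 s ≤ (QFun.at (fun h : Fin H => M.qStar h) 0) s
      ((gr fun h => M.qStar h).act 0 s) := by
  set qs : QFun S A H := fun h => M.qStar h with hqs
  have : Nonempty (Policy S A) := ⟨gr qs⟩
  refine ciSup_le fun π => (M.value_le_of_greedy_qStar hg H 0 (by omega) π s).trans (le_of_eq ?_)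
  rcases Nat.eq_zero_or_pos H with hH | hH
  · rw [qs.at_of_le (by omega), M.value_of_le _ (by omega)]
    rfl
  · rw [qs.at_of_lt hH, M.value_eq_qValue _ hH]
    exact (M.qStar_eq_qValue hg hH _ _).symm

end MDP

end VOlive

/-! ### Temporal differences and the policy loss decomposition -/

namespace VOlive

variable {S : Type u} {A : Type v} [MeasurableSpace S] [MeasurableSpace A] {H : ℕ}

/-- A measurable candidate with values in `[0, 1]`. -/
def QFun.IsRegular (f : QFun S A H) : Prop :=
  ∀ h, Measurable (fun q : S × A => f h q.1 q.2) ∧ ∀ s a, f h s a ∈ Set.Icc (0 : ℝ) 1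

lemma QFun.IsRegular.measurable_at {f : QFun S A H} (hf : f.IsRegular) (h : ℕ) :
    Measurable (fun q : S × A => f.at h q.1 q.2) := by
  rcases lt_or_ge h H with hh | hh
  · simpa only [f.at_of_lt hh] using (hf ⟨h, hh⟩).1
  · simp only [f.at_of_le hh, Pi.zero_apply]
    exact measurable_const

lemma QFun.IsRegular.at_mem {f : QFun S A H} (hf : f.IsRegular) (h : ℕ) (s : S) (a : A) :
    f.at h s a ∈ Set.Icc (0 : ℝ) 1 := by
  rcases lt_or_ge h H with hh | hh
  · simpa only [f.at_of_lt hh] using (hf ⟨h, hh⟩).2 s a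
  · simp [f.at_of_le hh]

lemma QFun.IsRegular.measurable_at_act {f : QFun S A H} (hf : f.IsRegular) (π : Policy S A)
    (h : ℕ) : Measurable (fun s => f.at h s (π.act h s)) :=
  (hf.measurable_at h).comp (f := fun s => (s, π.act h s))
    (measurable_id.prodMk (π.measurable_act h))

lemma QFun.IsRegular.measurable_iSup [Finite A] {f : QFun S A H} (hf : f.IsRegular)
    (h : ℕ) : Measurable (fun s => ⨆ a, f.at h s a) :=
  Measurable.iSup fun a => (hf.measurable_at h).comp (f := fun s => (s, a)) (by fun_prop)

lemma QFun.IsRegular.iSup_mem [Finite A] [Nonempty A] {f : QFun S A H} (hf : f.IsRegular)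
    (h : ℕ) (s : S) : ⨆ a, f.at h s a ∈ Set.Icc (0 : ℝ) 1 := by
  refine ⟨Real.iSup_nonneg fun a => (hf.at_mem h s a).1, ciSup_le fun a => (hf.at_mem h s a).2⟩

namespace MDP

section TemporalDifference

variable [Finite A] (M : MDP S A H) {f : QFun S A H}

lemma measurable_tdError (hf : f.IsRegular) (h : Fin H) : Measurable (M.tdError f h) := by
  unfold tdError
  refine Measurable.sub (Measurable.sub ?_ (M.measurable_r_tuple h)) ?_
  · exact (hf h).1.comp (f := fun z : Tuple S A => (z.1, z.2.1)) (by fun_prop)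
  · exact (hf.measurable_iSup (h + 1)).comp (f := fun z : Tuple S A => z.2.2) (by fun_prop)

variable [Nonempty A]

lemma abs_tdError_le (hf : f.IsRegular) (h : Fin H) (z : Tuple S A) : |M.tdError f h z| ≤ 2 := by
  have h1 := (hf h).2 z.1 z.2.1
  have h2 := M.r_nonneg h z.1 z.2.1
  have h3 := M.r_le_one h.2 z.1 z.2.1
  have h4 := hf.iSup_mem (h + 1) z.2.2
  rw [Set.mem_Icc] at h1 h4
  unfold tdError
  rw [abs_le]
  constructor <;> linarith

lemma integral_tdError (hf : f.IsRegular) (gr : QFun S A H → Policy S A) (h : Fin H) (s : S) :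
    ∫ s', M.tdError f h (s, (gr f).act h s, s') ∂(M.P h (s, (gr f).act h s)) =
      M.vResidual gr f h s := by
  unfold tdError vResidual bellman
  dsimp only
  rw [integral_sub (integrable_const _) (integrable_of_abs_le (b := 1) (hf.measurable_iSup _)
    fun x => abs_le.2 ⟨by linarith [(hf.iSup_mem (h + 1) x).1], (hf.iSup_mem _ x).2⟩)]
  simp
  ring

lemma integral_tdError_stepLaw (hf : f.IsRegular) (gr : QFun S A H → Policy S A) (h : Fin H)
    (s : S) : ∫ z, M.tdError f h z ∂(M.stepLaw (gr f).kernel h s) = M.vResidual gr f h s := by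
  rw [M.integral_stepLaw_dirac _ h s _ (policy_kernel_apply _ _ _) (M.measurable_tdError hf h)
    (M.abs_tdError_le hf h), M.integral_tdError hf gr]

lemma measurable_vResidual (hf : f.IsRegular) (gr : QFun S A H → Policy S A) (h : Fin H) :
    Measurable (M.vResidual gr f h) := by
  rw [show M.vResidual gr f h = _ from funext fun s => (M.integral_tdError_stepLaw hf gr h s).symm]
  exact measurable_integral_kernel _ (M.measurable_tdError hf h)

lemma abs_vResidual_le (hf : f.IsRegular) (gr : QFun S A H → Policy S A) (h : Fin H) (s : S) :
    |M.vResidual gr f h s| ≤ 2 := by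
  rw [← M.integral_tdError_stepLaw hf gr h s]
  exact abs_integral_le_of_abs_le (M.abs_tdError_le hf h)

/-- Expectation of the on-policy temporal difference. -/
lemma integral_tdError_episodeLaw (hf : f.IsRegular) (gr : QFun S A H → Policy S A)
    (h : Fin H) : ∫ τ, M.tdError f h (τ h) ∂(M.episodeLaw (gr f).kernel) =
      ∫ s, M.vResidual gr f h s ∂(M.stateLaw (gr f).kernel h 0 M.init) := by
  have := M.integral_trajLaw_eval (gr f).kernel 0 h M.init (M.measurable_tdError hf h)
    (M.abs_tdError_le hf h)
  simp only [Nat.zero_add, M.integral_tdError_stepLaw hf gr] at this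
  exact this

/-- Policy loss decomposition. -/
lemma at_sub_value_eq_sum (hf : f.IsRegular) {gr : QFun S A H → Policy S A}
    (hg : IsGreedy f (gr f)) :
    f.at 0 M.init ((gr f).act 0 M.init) - M.value (gr f) 0 M.init =
      ∑ h : Fin H, ∫ s, M.vResidual gr f h s ∂(M.stateLaw (gr f).kernel h 0 M.init) := by
  -- Residuals are extended by zero past the horizon, so that they can be indexed by `ℕ`.
  set φ : ℕ → S → ℝ := fun j s => if hj : j < H then M.vResidual gr f ⟨j, hj⟩ s else 0 with hφ
  have hφm : ∀ j, Measurable (φ j) := fun j => by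
    by_cases hj : j < H
    · simpa only [hφ, hj, dite_true] using M.measurable_vResidual hf gr ⟨j, hj⟩
    · simp only [hφ, hj, dite_false]
      exact measurable_const
  have hφb : ∀ j < H, ∀ s, |φ j s| ≤ 2 := fun j hj s => by
    simpa only [hφ, hj, dite_true] using M.abs_vResidual_le hf gr ⟨j, hj⟩ s
  -- Backward induction from every state. Greediness turns the maximum in the Bellman operator into
  -- `f_{h+1}` at the action of `π_f`, so the gap at `h` is the residual plus the expected gap at `h
  -- + 1`.
  have key : ∀ n h s, H ≤ h + n → f.at h s ((gr f).act h s) - M.value (gr f) h s =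
      ∑ i ∈ Finset.range (H - h), ∫ s', φ (h + i) s' ∂(M.stateLaw (gr f).kernel i h s) := by
    intro n
    induction n with
    | zero =>
      intro h s hh
      rw [Nat.sub_eq_zero_of_le (by omega), M.value_of_le _ (by omega), f.at_of_le (by omega)]
      simp
    | succ n ih =>
      intro h s hn
      rcases le_or_gt H h with hh | hh
      · rw [Nat.sub_eq_zero_of_le hh, M.value_of_le _ hh, f.at_of_le hh]
        simp
      have hm1 := hf.measurable_at_act (gr f) (h + 1)
      have hb1 : ∀ x, |f.at (h + 1) x ((gr f).act (h + 1) x)| ≤ 1 := fun x =>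
        abs_le.2 ⟨by linarith [(hf.at_mem (h + 1) x ((gr f).act (h + 1) x)).1],
          (hf.at_mem _ _ _).2⟩
      have hv := M.measurable_value (gr f) (h + 1)
      have hsub : Measurable fun x => f.at (h + 1) x ((gr f).act (h + 1) x) -
          M.value (gr f) (h + 1) x := hm1.sub hv
      have hvb := M.abs_value_le (gr f) (h + 1)
      rw [M.sum_integral_stateLaw (gr f).kernel hφm hφb hh s]
      simp only [← fun x => ih (h + 1) x (by omega)]
      rw [M.integral_transKernel_dirac _ h s _ (policy_kernel_apply _ _ _) hsub
          (b := 1 + H) fun x => (abs_sub _ _).trans (add_le_add (hb1 x) (hvb x)),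
        integral_sub (integrable_of_abs_le hm1 hb1) (integrable_of_abs_le hv hvb),
        M.value_eq (gr f) hh]
      simp only [hφ, hh, dite_true, vResidual, bellman, hg.iSup_eq, f.at_of_lt hh]
      ring
  rw [key H 0 M.init (by omega), Nat.sub_zero, Finset.sum_range]
  refine Finset.sum_congr rfl fun i _ => ?_
  simp [hφ]

end TemporalDifference

/-! ### Importance weighting under a uniformly random action -/

section Exploration

variable [Fintype A]

open Classical in
/-- The importance weight of the action prescribed by `π`, for uniformly random actions. -/
noncomputable def actionWeight (π : Policy S A) (t : ℕ) (z : Tuple S A) : ℝ :=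
  (if z.2.1 = π.act t z.1 then 1 else 0) / (1 / (Fintype.card A : ℝ))

lemma actionWeight_nonneg (π : Policy S A) (t : ℕ) (z : Tuple S A) : 0 ≤ actionWeight π t z := by
  unfold actionWeight
  split_ifs <;> positivity

lemma actionWeight_le (π : Policy S A) (t : ℕ) (z : Tuple S A) :
    actionWeight π t z ≤ Fintype.card A := by
  unfold actionWeight
  split_ifs <;> simp

lemma abs_actionWeight_mul_le (π : Policy S A) (t : ℕ) {φ : Tuple S A → ℝ} {b : ℝ}
    (hb : ∀ z, |φ z| ≤ b) (z : Tuple S A) : |actionWeight π t z * φ z| ≤ Fintype.card A * b := by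
  rw [abs_mul, abs_of_nonneg (actionWeight_nonneg _ _ _)]
  exact mul_le_mul (actionWeight_le _ _ _) (hb z) (abs_nonneg _) (Nat.cast_nonneg _)

variable [MeasurableSingletonClass A]

lemma measurable_actionWeight (π : Policy S A) (t : ℕ) :
    Measurable (actionWeight π t) := by
  classical
  unfold actionWeight
  refine Measurable.div_const (Measurable.ite ?_ measurable_const measurable_const) _
  exact measurableSet_eq_fun (by fun_prop) ((π.measurable_act t).comp measurable_fst)

lemma measurable_actionWeight_mul (π : Policy S A) (t : ℕ) {φ : Tuple S A → ℝ}
    (hφ : Measurable φ) : Measurable fun z => actionWeight π t z * φ z :=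
  (measurable_actionWeight π t).mul hφ

variable [Nonempty A] (M : MDP S A H)

instance (π : Policy S A) (t h : ℕ) : IsMarkovKernel (explore π t h) := by
  unfold explore
  infer_instance

/-- Only the action prescribed by `π'` contributes, and its probability `1/|A|` cancels the weight
`|A|`. A single exploration data set thus evaluates every candidate's own greedy action. -/
lemma integral_actionWeight_mul (π π' : Policy S A) (t : ℕ) (s : S) {φ : Tuple S A → ℝ} {b : ℝ}
    (hφ : Measurable φ) (hb : ∀ z, |φ z| ≤ b) :
    ∫ z, actionWeight π' t z * φ z ∂(M.stepLaw (explore π t) t s) =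
      ∫ s', φ (s, π'.act t s, s') ∂(M.P t (s, π'.act t s)) := by
  rw [M.integral_stepLaw _ t s (measurable_actionWeight_mul π' t hφ)
    (abs_actionWeight_mul_le π' t hb)]
  simp only [explore, Function.update_self, Kernel.const_apply]
  rw [PMF.integral_eq_sum, Finset.sum_eq_single (π'.act t s)]
  · have hc : (Fintype.card A : ℝ) ≠ 0 := Nat.cast_ne_zero.2 Fintype.card_ne_zero
    simp only [actionWeight, if_true, PMF.uniformOfFintype_apply, integral_const_mul, smul_eq_mul,
      ENNReal.toReal_inv, ENNReal.toReal_natCast]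
    field_simp
  · intro a _ ha
    simp [actionWeight, ha]
  · simp

lemma integral_actionWeight_mul_episodeLaw (π π' : Policy S A) (t : Fin H)
    {φ : Tuple S A → ℝ} {b : ℝ} (hφ : Measurable φ) (hb : ∀ z, |φ z| ≤ b) :
    ∫ τ, actionWeight π' t (τ t) * φ (τ t) ∂(M.episodeLaw (explore π t)) =
      ∫ s, ∫ s', φ (s, π'.act t s, s') ∂(M.P t (s, π'.act t s))
        ∂(M.stateLaw π.kernel t 0 M.init) := by
  have := M.integral_trajLaw_eval (explore π t) 0 t M.init
    (measurable_actionWeight_mul π' t hφ)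
    (abs_actionWeight_mul_le π' t hb)
  simp only [Nat.zero_add, M.integral_actionWeight_mul π π' t _ hφ hb] at this
  -- Exploration and `π` agree before step `t`.
  rw [← M.stateLaw_congr (κ := explore π t) (t : ℕ) 0
    fun j _ hj => Function.update_of_ne (by omega) _ _]
  exact this

variable {f : QFun S A H}

lemma integral_weighted_tdError (hf : f.IsRegular) (gr : QFun S A H → Policy S A)
    (π : Policy S A) (t : Fin H) :
    ∫ τ, actionWeight (gr f) t (τ t) * M.tdError f t (τ t) ∂(M.episodeLaw (explore π t)) =
      ∫ s, M.vResidual gr f t s ∂(M.stateLaw π.kernel t 0 M.init) := by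
  rw [M.integral_actionWeight_mul_episodeLaw π (gr f) t (M.measurable_tdError hf t)
    (M.abs_tdError_le hf t)]
  simp only [M.integral_tdError hf gr]

/-- The weight `w` lies in `[0, |A|]` and has mean `1`, so `E w² ≤ |A|`; squared temporal
differences are at most `4`. This saves a factor `|A|` over the bound from the range alone. -/
lemma integral_weighted_tdError_sq_le (hf : f.IsRegular) (gr : QFun S A H → Policy S A)
    (π : Policy S A) (t : Fin H) :
    ∫ τ, (actionWeight (gr f) t (τ t) * M.tdError f t (τ t)) ^ 2
      ∂(M.episodeLaw (explore π t)) ≤ 4 * Fintype.card A := by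
  -- The test function `1` gives the mean of the weight.
  have h1 := M.integral_actionWeight_mul_episodeLaw π (gr f) t (φ := fun _ => 1) (b := 1)
    measurable_const (by simp)
  simp only [integral_const, probReal_univ, smul_eq_mul, mul_one] at h1
  have hw : Measurable fun τ : Episode S A H => actionWeight (gr f) t (τ t) :=
    (measurable_actionWeight (gr f) t).comp (measurable_pi_apply t)
  have hwi : Integrable (fun τ : Episode S A H => actionWeight (gr f) t (τ t))
      (M.episodeLaw (explore π t)) :=
    integrable_of_abs_le (b := Fintype.card A) hw fun τ => by
      rw [abs_of_nonneg (actionWeight_nonneg _ _ _)]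
      exact actionWeight_le _ _ _
  calc _ ≤ ∫ τ, 4 * Fintype.card A * actionWeight (gr f) t (τ t)
        ∂(M.episodeLaw (explore π t)) := by
        refine integral_mono_of_nonneg (.of_forall fun τ => sq_nonneg _) (hwi.const_mul _)
          (.of_forall fun τ => ?_)
        have h2 := actionWeight_nonneg (gr f) t (τ t)
        have h3 := actionWeight_le (gr f) t (τ t)
        have h4 : M.tdError f t (τ t) ^ 2 ≤ 2 ^ 2 :=
          sq_le_sq' (abs_le.1 (M.abs_tdError_le hf t _)).1 (abs_le.1 (M.abs_tdError_le hf t _)).2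
        simp only [mul_pow, sq (actionWeight (gr f) t (τ t))]
        have h5 := mul_le_mul h3 h4 (sq_nonneg _) (Nat.cast_nonneg _)
        nlinarith [mul_le_mul_of_nonneg_left h5 h2]
    _ = 4 * Fintype.card A := by rw [integral_const_mul, h1, mul_one]

end Exploration

end MDP

end VOlive

/-! ### Measurability of elimination and concentration within one phase -/

namespace VOlive

variable {S : Type u} {A : Type v} [MeasurableSpace S] [MeasurableSpace A] {H : ℕ}

/-- Any function of the finite set of the indices whose events occur is measurable. -/
lemma measurable_comp_sep {X Y Z : Type*} [MeasurableSpace X] [MeasurableSpace Z] {B : Set Y}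
    (hB : B.Finite) {p : Y → X → Prop} (hp : ∀ y ∈ B, MeasurableSet {x | p y x})
    (G : Set Y → Z) : Measurable fun x => G {y ∈ B | p y x} := by
  have := hB.to_subtype
  -- Sets of candidates carry no σ-algebra here; the random subset is encoded by its indicators in
  -- the finite discrete space `B → Prop`.
  have h1 : Measurable fun (x : X) (y : B) => p y x :=
    measurable_pi_lambda _ fun y => measurableSet_setOfPred.1 (hp y y.2)
  have h2 : Measurable fun q : B → Prop => G {y | ∃ hy : y ∈ B, q ⟨y, hy⟩} :=
    Measurable.of_discrete
  have h3 : (fun x => G {y ∈ B | p y x}) =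
      (fun q : B → Prop => G {y | ∃ hy : y ∈ B, q ⟨y, hy⟩}) ∘ fun (x : X) (y : B) => p y x := by
    funext x
    simp only [Function.comp_apply]
    congr 1
    ext y
    simp
  rw [h3]
  exact h2.comp h1

namespace MDP

lemma measurable_actEstimate [Finite A] (M : MDP S A H) {n : ℕ} {f : QFun S A H}
    (hf : f.IsRegular) (h : Fin H) :
    Measurable fun D : Data S A H n => M.actEstimate f h D := by
  unfold actEstimate
  refine Measurable.const_mul (Finset.measurable_fun_sum _ fun i _ => ?_) _
  exact (M.measurable_tdError hf h).comp (f := fun D : Data S A H n => D i h) (by fun_prop)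

instance (M : MDP S A H) (κ : ℕ → Kernel S A) [∀ h, IsMarkovKernel (κ h)] (n : ℕ) :
    IsProbabilityMeasure (M.dataLaw κ n) := by
  unfold dataLaw
  infer_instance

/-- Expected V-type Bellman residual of `f` at step `h` under the roll-in policy `π`. -/
noncomputable def meanResidual (M : MDP S A H) (gr : QFun S A H → Policy S A) (π : Policy S A)
    (f : QFun S A H) (h : Fin H) : ℝ :=
  ∫ s, M.vResidual gr f h s ∂((M.episodeLaw π.kernel).map (fun τ => (τ h).1))

lemma meanResidual_eq (M : MDP S A H) (gr : QFun S A H → Policy S A) (π : Policy S A)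
    (f : QFun S A H) (h : Fin H) : M.meanResidual gr π f h =
      ∫ s, M.vResidual gr f h s ∂(M.stateLaw π.kernel h 0 M.init) := by
  rw [meanResidual, map_episodeLaw_state]

lemma measure_iUnion_le_ofReal {X ι : Type*} [MeasurableSpace X] [Fintype ι] {μ : Measure X}
    {T : ι → Set X} {y : ℝ} (hT : ∀ i, μ (T i) ≤ ENNReal.ofReal y) :
    μ (⋃ i, T i) ≤ ENNReal.ofReal (Fintype.card ι * y) := by
  refine (measure_iUnion_fintype_le _ _).trans ((Finset.sum_le_sum fun i _ => hT i).trans ?_)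
  rw [Finset.sum_const, Finset.card_univ, nsmul_eq_mul, ENNReal.ofReal_mul (Nat.cast_nonneg _),
    ENNReal.ofReal_natCast]

/-- Uniform concentration of the activation estimates. -/
lemma dataLaw_actEstimate_le [Finite A] [Nonempty A] (M : MDP S A H)
    (gr : QFun S A H → Policy S A) {f : QFun S A H} (hf : f.IsRegular) {n : ℕ} (hn : 0 < n)
    {t : ℝ} (ht : 0 ≤ t) (ht1 : t ≤ 1) :
    M.dataLaw (gr f).kernel n
        {D | ∃ h, t < |M.actEstimate f h D - M.meanResidual gr (gr f) f h|} ≤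
      ENNReal.ofReal (H * (2 * Real.exp (-(n * t ^ 2 / 16)))) := by
  have key := measure_iUnion_le_ofReal (μ := M.dataLaw (gr f).kernel n) (ι := Fin H)
    (T := fun h => {D | t < |M.actEstimate f h D - M.meanResidual gr (gr f) f h|})
    (y := 2 * Real.exp (-(n * t ^ 2 / 16))) fun h => by
      have hX : Measurable fun τ : Episode S A H => M.tdError f h (τ h) :=
        (M.measurable_tdError hf h).comp (measurable_pi_apply h)
      have hv : ∫ τ, M.tdError f h (τ h) ^ 2 ∂(M.episodeLaw (gr f).kernel) ≤ 4 := by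
        refine (le_abs_self _).trans (abs_integral_le_of_abs_le fun τ => ?_)
        rw [abs_pow]
        nlinarith [M.abs_tdError_le hf h (τ h), abs_nonneg (M.tdError f h (τ h))]
      have := measure_mean_deviation_le (n := n) (t := t) hX
        (fun τ => M.abs_tdError_le hf h (τ h)) hv (by norm_num) ht (by linarith) hn
      rw [M.integral_tdError_episodeLaw hf gr h, ← M.meanResidual_eq] at this
      norm_num only at this
      exact this
  rw [Fintype.card_fin] at key
  convert key using 2
  ext D
  simp

section Elimination

variable [Fintype A]

lemma elimEstimate_eq (M : MDP S A H) {n : ℕ} (gr : QFun S A H → Policy S A)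
    (f : QFun S A H) (h : Fin H) (D : Data S A H n) : M.elimEstimate gr f h D =
      (1 / (n : ℝ)) * ∑ i, actionWeight (gr f) h (D i h) * M.tdError f h (D i h) := rfl

variable [MeasurableSingletonClass A]

lemma measurable_elimEstimate (M : MDP S A H) {n : ℕ} (gr : QFun S A H → Policy S A)
    {f : QFun S A H} (hf : f.IsRegular) (h : Fin H) :
    Measurable fun D : Data S A H n => M.elimEstimate gr f h D := by
  simp only [elimEstimate_eq]
  refine Measurable.const_mul (Finset.measurable_fun_sum _ fun i _ => ?_) _
  exact (measurable_actionWeight_mul (gr f) h (M.measurable_tdError hf h)).comp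
    (f := fun D : Data S A H n => D i h) (by fun_prop)

variable [Nonempty A]

/-- Uniform concentration of the elimination estimates. -/
lemma dataLaw_elimEstimate_le (M : MDP S A H) (gr : QFun S A H → Policy S A)
    {F : Set (QFun S A H)} (hF : F.Finite) (hreg : ∀ f ∈ F, f.IsRegular) (π : Policy S A)
    (h : Fin H) {n : ℕ} (hn : 0 < n) {t : ℝ} (ht : 0 ≤ t) (ht1 : t ≤ 1) :
    M.dataLaw (explore π h) n
        {D | ∃ f ∈ F, t < |M.elimEstimate gr f h D - M.meanResidual gr π f h|} ≤
      ENNReal.ofReal (F.ncard *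
        (2 * Real.exp (-(n * t ^ 2 / (16 * Fintype.card A))))) := by
  have := hF.fintype
  have hA : (0 : ℝ) < Fintype.card A := Nat.cast_pos.2 Fintype.card_pos
  have key := measure_iUnion_le_ofReal (μ := M.dataLaw (explore π h) n) (ι := F)
    (T := fun f => {D | t < |M.elimEstimate gr f h D - M.meanResidual gr π f h|})
    (y := 2 * Real.exp (-(n * t ^ 2 / (16 * Fintype.card A)))) fun f => by
      have hf := hreg f f.2
      have hX : Measurable fun τ : Episode S A H =>
          actionWeight (gr f) h (τ h) * M.tdError f h (τ h) :=
        (measurable_actionWeight_mul (gr f) h (M.measurable_tdError hf h)).comp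
          (measurable_pi_apply h)
      -- Range `b = 2|A|` and second moment `v = 4|A|`, so the side condition `t b ≤ 2v` reads `t ≤
      -- 4`.
      have := measure_mean_deviation_le (n := n) (t := t) (μ := M.episodeLaw (explore π h)) hX
        (fun τ => abs_actionWeight_mul_le (gr f) h (M.abs_tdError_le hf h) (τ h))
        (M.integral_weighted_tdError_sq_le hf gr π h) (by positivity) ht (by nlinarith) hn
      rw [M.integral_weighted_tdError hf gr π h, ← M.meanResidual_eq,
        show 4 * (4 * (Fintype.card A : ℝ)) = 16 * Fintype.card A by ring] at this
      exact this
  rw [← Nat.card_eq_fintype_card, Nat.card_coe_set_eq] at key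
  convert key using 2
  ext D
  simp

end Elimination

/-- The measures `ρ 0, …, ρ (n - 1)` witness that the Eluder dimension is at least `n`, at the
scale `ε`. -/
def IsEluderSequence {X : Type*} [MeasurableSpace X] (G : Set (X → ℝ)) (Pi : Set (Measure X))
    (ε : ℝ) (n : ℕ) (ρ : ℕ → Measure X) : Prop :=
  (∀ i < n, ρ i ∈ Pi) ∧ ∀ i < n, EpsIndependent G ε (fun j : Fin i => ρ j) (ρ i)

lemma IsEluderSequence.le_deDim {X : Type*} [MeasurableSpace X] {G : Set (X → ℝ)}
    {Pi : Set (Measure X)} {ε : ℝ} {n : ℕ} {ρ : ℕ → Measure X}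
    (h : IsEluderSequence G Pi ε n ρ) : (n : ℕ∞) ≤ deDim G Pi ε := by
  unfold deDim
  exact le_iSup₂ (f := fun (n : ℕ) (_ : n ∈ {n : ℕ | ∃ ρ : ℕ → Measure X, (∀ i < n, ρ i ∈ Pi) ∧
    ∃ ε' ≥ ε, ∀ i < n, EpsIndependent G ε' (fun j : Fin i => ρ j) (ρ i)}) => (n : ℕ∞)) n
    ⟨ρ, h.1, ε, le_rfl, h.2⟩

lemma IsEluderSequence.snoc {X : Type*} [MeasurableSpace X] {G : Set (X → ℝ)}
    {Pi : Set (Measure X)} {ε : ℝ} {n : ℕ} {ρ : ℕ → Measure X}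
    (h : IsEluderSequence G Pi ε n ρ) {ν : Measure X} (hν : ν ∈ Pi)
    (hind : EpsIndependent G ε (fun j : Fin n => ρ j) ν) :
    IsEluderSequence G Pi ε (n + 1) (Function.update ρ n ν) := by
  have hne : ∀ i < n, Function.update ρ n ν i = ρ i := fun i hi =>
    Function.update_of_ne (by omega) _ _
  refine ⟨fun i hi => ?_, fun i hi => ?_⟩
  · rcases Nat.lt_succ_iff_lt_or_eq.1 hi with h1 | rfl
    · rw [hne i h1]
      exact h.1 i h1
    · simpa using hν
  · have hpre : (fun j : Fin i => Function.update ρ n ν j) = fun j : Fin i => ρ j :=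
      funext fun j => hne j (by omega)
    rw [hpre]
    rcases Nat.lt_succ_iff_lt_or_eq.1 hi with h1 | rfl
    · rw [hne i h1]
      exact h.2 i h1
    · simpa using hind

/-- `n` previous roll-in distributions at step `h`, each independent of its predecessors, for
which all elements of `B` have small mean residuals. -/
def HasHistory (M : MDP S A H) (gr : QFun S A H → Policy S A) (F B : Set (QFun S A H))
    (ε η : ℝ) (h : Fin H) (n : ℕ) : Prop :=
  ∃ ρ : ℕ → Measure S, IsEluderSequence (M.vResidualClass gr F h) (M.rollIn gr F h) ε n ρ ∧
    ∀ g ∈ B, ∀ i < n, |∫ s, M.vResidual gr g h s ∂(ρ i)| ≤ η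

/-! ### Independent roll-ins and the dimension bound -/

section History

variable {M : MDP S A H} {gr : QFun S A H → Policy S A} {F B B' : Set (QFun S A H)} {ε η : ℝ}
  {h : Fin H} {n d : ℕ}

lemma HasHistory.le (hh : M.HasHistory gr F B ε η h n) (hd : M.vbeDim gr F ε ≤ d) : n ≤ d := by
  obtain ⟨ρ, hρ, -⟩ := hh
  have := (hρ.le_deDim.trans (le_iSup (fun h : Fin H =>
    deDim (M.vResidualClass gr F h) (M.rollIn gr F h) ε) h)).trans hd
  exact_mod_cast this

lemma HasHistory.mono (hh : M.HasHistory gr F B ε η h n) (hB : B' ⊆ B) :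
    M.HasHistory gr F B' ε η h n := by
  obtain ⟨ρ, hρ, hs⟩ := hh
  exact ⟨ρ, hρ, fun g hg => hs g (hB hg)⟩

/-- The surviving `f` has squared residuals summing to at most `n η² ≤ d η² ≤ ε²` over the history,
yet exceeds `ε` under its own roll-in, so it witnesses independence. The bound `n ≤ d` comes from
the dimension applied to the history before the extension. -/
lemma HasHistory.snoc (hh : M.HasHistory gr F B ε η h n) (hd : M.vbeDim gr F ε ≤ d)
    (hη : 0 ≤ η) (hε : Real.sqrt d * η ≤ ε) (hB : B' ⊆ B) {f : QFun S A H} (hfB : f ∈ B)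
    (hfF : f ∈ F) (hf : ε < M.meanResidual gr (gr f) f h)
    (hB' : ∀ g ∈ B', |M.meanResidual gr (gr f) g h| ≤ η) :
    M.HasHistory gr F B' ε η h (n + 1) := by
  have hn := hh.le hd
  obtain ⟨ρ, hρ, hs⟩ := hh
  refine ⟨_, hρ.snoc ⟨f, hfF, rfl⟩ ⟨_, ⟨f, hfF, rfl⟩, ?_, hf.trans_le (le_abs_self _)⟩, ?_⟩
  · refine le_trans ?_ hε
    rw [Real.sqrt_le_left (by positivity), mul_pow, Real.sq_sqrt (Nat.cast_nonneg _)]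
    calc ∑ i : Fin n, (∫ x, M.vResidual gr f h x ∂(ρ i)) ^ 2 ≤ ∑ _i : Fin n, η ^ 2 :=
          Finset.sum_le_sum fun i _ => sq_le_sq' (abs_le.1 (hs f hfB i i.2)).1
            (abs_le.1 (hs f hfB i i.2)).2
      _ = n * η ^ 2 := by simp
      _ ≤ d * η ^ 2 := by gcongr
  · intro g hg i hi
    rcases Nat.lt_succ_iff_lt_or_eq.1 hi with h1 | rfl
    · rw [Function.update_of_ne (by omega)]
      exact hs g (hB hg) i h1
    · rw [Function.update_self]
      exact hB' g hg

end History

/-! ### Induction over the phases -/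

section Run

variable [Fintype A] [Nonempty A]

/-- Optimism bounds `V^⋆` by the prediction of `f`, and the loss decomposition bounds the prediction
by the value plus the residuals. -/
lemma isOptimalUpTo_of_sum_le {M : MDP S A H} {gr : QFun S A H → Policy S A}
    {f : QFun S A H} {ε : ℝ} (hf : f.IsRegular) (hg : IsGreedy f (gr f))
    (hqs : IsGreedy (fun h : Fin H => M.qStar h) (gr fun h => M.qStar h))
    (hmax : (QFun.at (fun h : Fin H => M.qStar h) 0) M.init
      ((gr fun h => M.qStar h).act 0 M.init) ≤ f.at 0 M.init ((gr f).act 0 M.init))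
    (hsum : ∑ h, M.meanResidual gr (gr f) f h ≤ ε) : M.IsOptimalUpTo ε (gr f) := by
  have h1 := M.at_sub_value_eq_sum hf hg
  have h2 := M.valueStar_le gr hqs M.init
  simp only [← meanResidual_eq] at h1
  unfold IsOptimalUpTo
  linarith

variable [MeasurableSingletonClass A]

/-- The guarantee for V-type OLIVE started from a version space that contains `Q^⋆`. -/
theorem le_oliveLaw (M : MDP S A H) (gr : QFun S A H → Policy S A) {F : Set (QFun S A H)}
    (hF : F.Finite) (hreg : ∀ f ∈ F, f.IsRegular) (hgr : ∀ f ∈ F, IsGreedy f (gr f))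
    (hq : (fun h : Fin H => M.qStar h) ∈ F) {p : Params} {ch : Choices S A H p.nAct}
    (hch : ch.Valid M gr F p) {ε ya ye : ℝ} {d : ℕ} (hya : 0 ≤ ya) (hye : 0 ≤ ye)
    (hza : p.zetaAct = 2 * ε) (hze0 : 0 ≤ p.zetaElim)
    (hze : Real.sqrt d * (2 * p.zetaElim) ≤ ε) (hd : M.vbeDim gr F ε ≤ d)
    (hact : ∀ f ∈ F, M.dataLaw (gr f).kernel p.nAct
      {D | ∃ h, ε < |M.actEstimate f h D - M.meanResidual gr (gr f) f h|} ≤ ENNReal.ofReal ya)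
    (helim : ∀ f ∈ F, ∀ t : Fin H, M.dataLaw (explore (gr f) t) p.nElim
      {D | ∃ g ∈ F, p.zetaElim < |M.elimEstimate gr g t D - M.meanResidual gr (gr f) g t|} ≤
        ENNReal.ofReal ye)
    (total N k : ℕ) (B : Set (QFun S A H)) (m : ℕ) (hB : B ⊆ F)
    (hqB : (fun h : Fin H => M.qStar h) ∈ B) (n : Fin H → ℕ)
    (hn : ∀ h, M.HasHistory gr F B ε (2 * p.zetaElim) h (n h)) (hN : H * d < N + ∑ h, n h)
    (htot : m + N * (p.nAct + p.nElim) ≤ total) :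
    ENNReal.ofReal (1 - N * (ya + ye)) ≤ M.oliveLaw gr p ch N k B m
      {o | ∃ π n, o = Outcome.done π n ∧ M.IsOptimalUpTo (3 * (H * ε)) π ∧ n ≤ total} := by
  induction N generalizing k B m n with
  | zero =>
    exfalso
    -- With no phases left the histories would have total length above `H d`, though each has length
    -- at most `d`.
    have : ∑ h, n h ≤ ∑ _h : Fin H, d := Finset.sum_le_sum fun h _ => (hn h).le hd
    simp at this
    omega
  | succ N ih =>
    set qs : QFun S A H := fun h : Fin H => M.qStar h with hqs
    set E : Set (Outcome S A) :=
      {o | ∃ π n, o = Outcome.done π n ∧ M.IsOptimalUpTo (3 * (H * ε)) π ∧ n ≤ total} with hE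
    have hEm : MeasurableSet E := trivial
    have hBn : B.Nonempty := ⟨_, hqB⟩
    set f := ch.optimist k B with hfdef
    have hfB : f ∈ B := hch.optimist_mem k B hB hBn
    have hfF := hB hfB
    have hfr := hreg f hfF
    set next : Fin H → Data S A H p.nElim → Measure (Outcome S A) := fun t D' =>
      M.oliveLaw gr p ch N (k + 1) {g ∈ B | |M.elimEstimate gr g t D'| ≤ p.zetaElim}
        (m + p.nAct + p.nElim) with hnext
    have hnextm : ∀ t, Measurable (next t) := fun t =>
      measurable_comp_sep (hF.subset hB)
        (fun g hg => measurableSet_le (M.measurable_elimEstimate gr (hreg g (hB hg)) t).abs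
          measurable_const)
        (fun B' => M.oliveLaw gr p ch N (k + 1) B' (m + p.nAct + p.nElim))
    have hcont : Measurable fun D : Data S A H p.nAct =>
        (M.dataLaw (explore (gr f) (ch.pick k B D)) p.nElim).bind (next (ch.pick k B D)) :=
      (Measurable.of_discrete (f := fun t : Fin H =>
        (M.dataLaw (explore (gr f) t) p.nElim).bind (next t))).comp
          (hch.measurable_pick k B hB hBn)
    have hterm : MeasurableSet {D : Data S A H p.nAct |
        ∑ h, M.actEstimate f h D ≤ H * p.zetaAct} :=
      measurableSet_le (Finset.measurable_fun_sum _ fun h _ => M.measurable_actEstimate hfr h)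
        measurable_const
    have hlaw : M.oliveLaw gr p ch (N + 1) k B m =
        (M.dataLaw (gr f).kernel p.nAct).bind fun D =>
          if ∑ h, M.actEstimate f h D ≤ H * p.zetaAct then
            Measure.dirac (Outcome.done (gr f) (m + p.nAct))
          else (M.dataLaw (explore (gr f) (ch.pick k B D)) p.nElim).bind
            (next (ch.pick k B D)) := rfl
    rw [hlaw, Measure.bind_apply hEm (Measurable.ite hterm measurable_const hcont).aemeasurable]
    -- Each phase consumes `ya` for activation and `ye` for elimination of the failure budget.
    rw [show (1 - ((N + 1 : ℕ) : ℝ) * (ya + ye)) = 1 - ((N * (ya + ye) + ye) + ya) by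
      push_cast; ring]
    refine ofReal_sub_le_lintegral (by positivity) hya (hact f hfF) fun D hD => ?_
    simp only [Set.mem_ofPred_eq, not_exists, not_lt] at hD
    split_ifs with hcond
    · have hmem : Outcome.done (gr f) (m + p.nAct) ∈ E := by
        refine ⟨_, _, rfl, isOptimalUpTo_of_sum_le hfr (hgr f hfF) (hgr _ hq)
          (hch.optimist_max k B hB hBn _ hqB) ?_, ?_⟩
        -- The stopping threshold contributes `2 H ε` and the estimation error `H ε`; here `ε` is
        -- the per-step accuracy.
        · calc ∑ h, M.meanResidual gr (gr f) f h ≤ ∑ h, (M.actEstimate f h D + ε) :=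
                Finset.sum_le_sum fun h _ => by linarith [(abs_le.1 (hD h)).1]
            _ = ∑ h, M.actEstimate f h D + H * ε := by simp [Finset.sum_add_distrib]
            _ ≤ 3 * (H * ε) := by
                rw [hza] at hcond
                linarith
        · rw [Nat.succ_mul] at htot
          omega
      rw [Measure.dirac_apply_of_mem hmem]
      refine ENNReal.ofReal_le_one.2 ?_
      have : 0 ≤ N * (ya + ye) + ye := by positivity
      linarith
    · set t := ch.pick k B D with htdef
      rw [Measure.bind_apply hEm (hnextm t).aemeasurable]
      refine ofReal_sub_le_lintegral (by positivity) hye (helim f hfF t) fun D' hD' => ?_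
      simp only [Set.mem_ofPred_eq, not_exists, not_and, not_lt] at hD'
      have hact_t : p.zetaAct < M.actEstimate f t D := by
        refine hch.pick_spec k B hB hBn D ?_
        -- If no step exceeded `ζ_act`, the sum would have passed the termination test.
        by_contra! hle
        refine hcond ((Finset.sum_le_sum fun h _ => hle h).trans ?_)
        simp
      have hbig : ε < M.meanResidual gr (gr f) f t := by
        linarith [(abs_le.1 (hD t)).2]
      have hsub : {g ∈ B | |M.elimEstimate gr g t D'| ≤ p.zetaElim} ⊆ B := Set.sep_subset _ _
      refine ih (k + 1) {g ∈ B | |M.elimEstimate gr g t D'| ≤ p.zetaElim}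
        (m + p.nAct + p.nElim) (hsub.trans hB) ⟨hqB, ?_⟩
        (Function.update n t (n t + 1)) (fun h => ?_) ?_ ?_
      -- `Q^⋆` survives: its mean residual is zero, so its estimate is within `ζ_elim` of zero.
      · have h0 : M.meanResidual gr (gr f) qs t = 0 := by
          simp only [meanResidual, hqs, M.vResidual_qStar gr (hgr _ hq), integral_zero]
        simpa [h0] using hD' qs hq
      · by_cases hht : h = t
        · subst hht
          rw [Function.update_self]
          refine (hn t).snoc hd (by positivity) hze hsub hfB hfF hbig fun g hg => ?_
          -- Survivors have estimates at most `ζ_elim` in absolute value, each with error at most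
          -- `ζ_elim`; hence the history threshold `2 ζ_elim`.
          have h1 := abs_le.1 (hD' g (hB hg.1))
          have h2 := abs_le.1 hg.2
          exact abs_le.2 ⟨by linarith, by linarith⟩
        · rw [Function.update_of_ne hht]
          exact (hn h).mono hsub
      -- One phase fewer is balanced by a history longer by one.
      · rw [Finset.sum_update_of_mem (Finset.mem_univ t)]
        have := Finset.add_sum_erase Finset.univ n (Finset.mem_univ t)
        rw [Finset.sdiff_singleton_eq_erase]
        omega
      · rw [Nat.succ_mul] at htot
        omega

end Run

end MDP

end VOlive

/-! ### Arithmetic of the parameters -/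

namespace VOlive

section Parameters

variable {H d nA nF : ℕ} {δ ε : ℝ}

lemma log_two_le_log_ratio (hε : 0 < ε) (hδ : 0 < δ) (hX : 2 * (δ * ε) ≤ (H : ℝ) * d * nA) :
    Real.log 2 ≤ Real.log ((H : ℝ) * d * nA / (δ * ε)) :=
  Real.log_le_log (by norm_num) ((le_div_iff₀ (by positivity)).2 hX)

/-- With these sample sizes, the failure probabilities sum up to at most `δ`. -/
lemma failure_le (hF : 2 ≤ nF) (hε : 0 < ε) (hε1 : ε ≤ 1) (hδ : 0 < δ) (hδ1 : δ ≤ 1)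
    (hH : 1 ≤ H) (hd : 1 ≤ d) (hA : 1 ≤ nA) (hX : 2 * (δ * ε) ≤ (H : ℝ) * d * nA) :
    ((H * d + 1 : ℕ) : ℝ) *
      (H * (2 * Real.exp (-((oliveParams 640 H d nA nF δ ε).nAct * (ε / H) ^ 2 / 16))) +
        nF * (2 * Real.exp (-((oliveParams 640 H d nA nF δ ε).nElim *
          (oliveParams 640 H d nA nF δ ε).zetaElim ^ 2 / (16 * nA))))) ≤ δ := by
  have hH' : (1 : ℝ) ≤ H := by exact_mod_cast hH
  have hd' : (1 : ℝ) ≤ d := by exact_mod_cast hd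
  have hA' : (1 : ℝ) ≤ nA := by exact_mod_cast hA
  have hF' : (2 : ℝ) ≤ nF := by exact_mod_cast hF
  have hHd : (1 : ℝ) ≤ H * d := one_le_mul_of_one_le_of_one_le hH' hd'
  set X := (H : ℝ) * d * nA / (δ * ε) with hXdef
  set l := Real.log X with hl
  set L := Real.log nF with hL
  have hX2 : 2 ≤ X := (le_div_iff₀ (by positivity)).2 hX
  -- One power of `X` absorbs the number of phases and the factor `1/δ`; the powers `X ^ 5` and `X ^
  -- 4` below leave `X ^ 3 ≥ 8` for the constants.
  have hXHd : H * d ≤ δ * X := by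
    rw [hXdef, mul_div_assoc', le_div_iff₀ (by positivity)]
    calc H * d * (δ * ε) ≤ H * d * (δ * 1) := by gcongr
      _ ≤ H * d * (δ * nA) := by gcongr
      _ = δ * (H * d * nA) := by ring
  have hXH : H ≤ X := by nlinarith
  have hl2 : 0.69 ≤ l := by
    linarith [Real.log_two_gt_d9, log_two_le_log_ratio hε hδ hX]
  have hL2 : 0.69 ≤ L := by
    linarith [Real.log_two_gt_d9, Real.log_le_log (by norm_num) hF']
  have hexp : ∀ n : ℕ, Real.exp (-(n * l)) = (X ^ n)⁻¹ := fun n => by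
    rw [Real.exp_neg, Real.exp_nat_mul, hl, Real.exp_log (by linarith)]
  have hX3 : 8 ≤ X ^ 3 := by
    have := pow_le_pow_left₀ (by norm_num) hX2 3
    linarith
  have hact : H * (2 * Real.exp (-((oliveParams 640 H d nA nF δ ε).nAct * (ε / H) ^ 2 / 16))) ≤
      δ / (4 * (H * d)) := by
    have h1 : (5 : ℕ) * l ≤ (oliveParams 640 H d nA nF δ ε).nAct * (ε / H) ^ 2 / 16 := by
      have := Nat.le_ceil ((H : ℝ) ^ 2 * iota 640 H d nA δ ε / ε ^ 2)
      calc ((5 : ℕ) : ℝ) * l ≤ 640 * l / 16 := by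
            push_cast
            linarith
        _ = ((H : ℝ) ^ 2 * iota 640 H d nA δ ε / ε ^ 2) * (ε / H) ^ 2 / 16 := by
            unfold iota
            rw [← hXdef, ← hl]
            field_simp
        _ ≤ _ := by
            gcongr
            exact this
    calc _ ≤ H * (2 * Real.exp (-((5 : ℕ) * l))) := by gcongr
      _ = 2 * H / X ^ 5 := by
          rw [hexp]
          ring
      _ ≤ δ / (4 * (H * d)) := by
          rw [div_le_div_iff₀ (by positivity) (by positivity)]
          calc 2 * H * (4 * (H * d)) = 8 * ((H : ℝ) * (H * d)) := by ring
            _ ≤ X ^ 3 * (X * (δ * X)) := by gcongr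
            _ = δ * X ^ 5 := by ring
  have helim : nF * (2 * Real.exp (-((oliveParams 640 H d nA nF δ ε).nElim *
      (oliveParams 640 H d nA nF δ ε).zetaElim ^ 2 / (16 * nA)))) ≤ δ / (4 * (H * d)) := by
    have h1 : L + (4 : ℕ) * l ≤ (oliveParams 640 H d nA nF δ ε).nElim *
        (oliveParams 640 H d nA nF δ ε).zetaElim ^ 2 / (16 * nA) := by
      have := Nat.le_ceil ((H : ℝ) ^ 2 * d * nA * Real.log nF * iota 640 H d nA δ ε / ε ^ 2)
      -- This determines `c = 640`: the exponent is `10 L l`, and as `L` and `l` are at least `0.69`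
      -- it covers both `L`, for the union over the class, and `4 l`.
      calc L + (4 : ℕ) * l ≤ L * (640 * l) / 64 := by
            push_cast
            nlinarith
        _ = ((H : ℝ) ^ 2 * d * nA * Real.log nF * iota 640 H d nA δ ε / ε ^ 2) *
              (ε / (2 * H * Real.sqrt d)) ^ 2 / (16 * nA) := by
            unfold iota
            rw [← hXdef, ← hl, ← hL, div_pow, mul_pow, Real.sq_sqrt (by positivity)]
            field_simp
            norm_num
        _ ≤ _ := by
            unfold oliveParams
            gcongr
    calc _ ≤ nF * (2 * Real.exp (-(L + (4 : ℕ) * l))) := by gcongr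
      _ = 2 / X ^ 4 := by
          rw [neg_add, Real.exp_add, hexp, Real.exp_neg, hL, Real.exp_log (by linarith)]
          field_simp
      _ ≤ δ / (4 * (H * d)) := by
          rw [div_le_div_iff₀ (by positivity) (by positivity)]
          calc 2 * (4 * ((H : ℝ) * d)) = 8 * (H * d) := by ring
            _ ≤ X ^ 3 * (δ * X) := by gcongr
            _ = δ * X ^ 4 := by ring
  calc _ ≤ (2 * (H * d) : ℝ) * (δ / (4 * (H * d)) + δ / (4 * (H * d))) := by
        gcongr
        push_cast
        linarith
    _ = δ := by
        field_simp
        norm_num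

lemma episodes_le (hF : 2 ≤ nF) (hε : 0 < ε) (hε1 : ε ≤ 1) (hδ : 0 < δ)
    (hH : 1 ≤ H) (hd : 1 ≤ d) (hA : 1 ≤ nA) (hX : 2 * (δ * ε) ≤ (H : ℝ) * d * nA) :
    (((H * d + 1) * ((oliveParams 640 H d nA nF δ ε).nAct +
      (oliveParams 640 H d nA nF δ ε).nElim) : ℕ) : ℝ) ≤
      16 * ((H : ℝ) ^ 3 * d ^ 2 * nA * Real.log nF * iota 640 H d nA δ ε / ε ^ 2) := by
  have hH' : (1 : ℝ) ≤ H := by exact_mod_cast hH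
  have hd' : (1 : ℝ) ≤ d := by exact_mod_cast hd
  have hA' : (1 : ℝ) ≤ nA := by exact_mod_cast hA
  have hF' : (2 : ℝ) ≤ nF := by exact_mod_cast hF
  have hHd : (1 : ℝ) ≤ H * d := one_le_mul_of_one_le_of_one_le hH' hd'
  set i := iota 640 H d nA δ ε with hi
  have hi2 : 2 ≤ i := by
    have := log_two_le_log_ratio hε hδ hX
    rw [hi, iota]
    linarith [Real.log_two_gt_d9]
  set L := Real.log nF with hL
  have hL2 : 1 / 2 ≤ L := by
    linarith [Real.log_two_gt_d9, Real.log_le_log (by norm_num) hF']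
  set Y := (H : ℝ) ^ 2 * i / ε ^ 2 with hY
  -- With `Y ≤ 2 W` this gives `W ≥ 1`, so the rounding in both sample sizes is absorbed: their sum
  -- is at most `3 W + 2 ≤ 8 W`. Together with `H d + 1 ≤ 2 H d` this yields the constant `16`.
  have hY2 : 2 ≤ Y := by
    rw [hY, le_div_iff₀ (by positivity)]
    have h1 : ε ^ 2 ≤ 1 := pow_le_one₀ hε.le hε1
    have h2 : 1 ≤ (H : ℝ) ^ 2 := one_le_pow₀ hH'
    nlinarith
  set W := (H : ℝ) ^ 2 * d * nA * L * i / ε ^ 2 with hW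
  have hYW : Y ≤ 2 * W := by
    have h1 : 1 ≤ (d : ℝ) * nA := one_le_mul_of_one_le_of_one_le hd' hA'
    have h2 : 1 ≤ 2 * (d * nA * L) := by nlinarith
    calc Y ≤ Y * (2 * (d * nA * L)) := le_mul_of_one_le_right (by linarith) h2
      _ = 2 * W := by
        rw [hY, hW]
        ring
  have h1 : ((oliveParams 640 H d nA nF δ ε).nAct : ℝ) ≤ Y + 1 :=
    (Nat.ceil_lt_add_one (by linarith)).le
  have h2 : ((oliveParams 640 H d nA nF δ ε).nElim : ℝ) ≤ W + 1 :=
    (Nat.ceil_lt_add_one (by linarith)).le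
  push_cast
  calc _ ≤ (2 * (H * d) : ℝ) * (8 * W) := by
        gcongr <;> linarith
    _ = _ := by
        rw [hW]
        ring

lemma nAct_pos (hε : 0 < ε) (hδ : 0 < δ) (hH : 1 ≤ H)
    (hX : 2 * (δ * ε) ≤ (H : ℝ) * d * nA) : 0 < (oliveParams 640 H d nA nF δ ε).nAct := by
  have h1 := log_two_le_log_ratio hε hδ hX
  have h2 := Real.log_two_gt_d9
  have h3 : 0 < iota 640 H d nA δ ε := by
    unfold iota
    linarith
  have h4 : (0 : ℝ) < H := by exact_mod_cast hH
  exact Nat.ceil_pos.2 (by positivity)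

lemma nElim_pos (hF : 2 ≤ nF) (hε : 0 < ε) (hδ : 0 < δ) (hH : 1 ≤ H) (hd : 1 ≤ d) (hA : 1 ≤ nA)
    (hX : 2 * (δ * ε) ≤ (H : ℝ) * d * nA) : 0 < (oliveParams 640 H d nA nF δ ε).nElim := by
  have h1 := log_two_le_log_ratio hε hδ hX
  have h2 := Real.log_two_gt_d9
  have h3 : 0 < iota 640 H d nA δ ε := by
    unfold iota
    linarith
  have h4 : (0 : ℝ) < H := by exact_mod_cast hH
  have h5 : (0 : ℝ) < d := by exact_mod_cast hd
  have h6 : (0 : ℝ) < nA := by exact_mod_cast hA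
  have h7 : 0 < Real.log nF := Real.log_pos (by exact_mod_cast hF)
  exact Nat.ceil_pos.2 (by positivity)

end Parameters

end VOlive

theorem mainTheorem8 :
    ∃ c C₁ C₂ : ℝ, 0 < c ∧ 0 < C₁ ∧ 0 < C₂ ∧
      ∀ (S : Type u) (A : Type v) [MeasurableSpace S] [MeasurableSpace A]
        [MeasurableSingletonClass A] [Fintype A] [Nonempty A]
        (H : ℕ) (M : MDP S A H)
        (F : Fin H → Set (S → A → ℝ)) (gr : QFun S A H → Policy S A)
        (d : ℕ) (ε δ : ℝ),
        -- the class is finite, with at least two elements, and consists of measurable functions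
        -- with values in `[0, 1]`
        (productClass F).Finite → 2 ≤ (productClass F).ncard →
        (∀ h, ∀ f ∈ F h, Measurable (fun q : S × A => f q.1 q.2) ∧
          ∀ s a, f s a ∈ Set.Icc (0 : ℝ) 1) →
        -- `gr f` is a greedy policy of `f`
        (∀ f ∈ productClass F, IsGreedy f (gr f)) →
        -- realizability
        (∀ h : Fin H, M.qStar h ∈ F h) →
        0 < ε → ε ≤ 1 → 0 < δ → δ ≤ 1 → 1 ≤ H → 1 ≤ d →
        2 * (δ * ε) ≤ (H : ℝ) * d * Fintype.card A →
        M.vbeDim gr (productClass F) (ε / H) ≤ (d : ℕ∞) →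
        ∀ ch : Choices S A H
            (oliveParams c H d (Fintype.card A) (productClass F).ncard δ ε).nAct,
          Choices.Valid M gr (productClass F)
            (oliveParams c H d (Fintype.card A) (productClass F).ncard δ ε) ch →
          ENNReal.ofReal (1 - δ) ≤
            M.oliveProb gr (productClass F)
              (oliveParams c H d (Fintype.card A) (productClass F).ncard δ ε) ch
              (fun π n => M.IsOptimalUpTo (C₁ * ε) π ∧
                (n : ℝ) ≤ C₂ * ((H : ℝ) ^ 3 * d ^ 2 * Fintype.card A *
                  Real.log (productClass F).ncard *
                    iota c H d (Fintype.card A) δ ε / ε ^ 2)) := by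

  refine ⟨640, 3, 16, by norm_num, by norm_num, by norm_num, ?_⟩
  intro S A _ _ _ _ _ H M F gr d ε δ hfin hcard hreg hgr hreal hε hε1 hδ hδ1 hH hd hX hdim
  have hA : 1 ≤ Fintype.card A := Fintype.card_pos
  set p := oliveParams 640 H d (Fintype.card A) (productClass F).ncard δ ε with hp
  intro ch hch
  have hH' : (1 : ℝ) ≤ H := by exact_mod_cast hH
  have hd' : (1 : ℝ) ≤ d := by exact_mod_cast hd
  have hs : 1 ≤ Real.sqrt d := Real.one_le_sqrt.2 hd'
  have hregular : ∀ f ∈ productClass F, f.IsRegular := fun f hf h =>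
    hreg h (f h) (hf h (Set.mem_univ h))
  have hq : (fun h : Fin H => M.qStar h) ∈ productClass F := fun h _ => hreal h
  have hze : p.zetaElim = ε / (2 * H * Real.sqrt d) := rfl
  have hze0 : 0 ≤ p.zetaElim := by
    rw [hze]
    positivity
  have hze1 : p.zetaElim ≤ 1 := by
    rw [hze, div_le_one (by positivity)]
    nlinarith
  have hn1 : 0 < p.nAct := nAct_pos hε hδ hH hX
  have hn2 : 0 < p.nElim := nElim_pos hcard hε hδ hH hd hA hX
  -- The run starts with empty histories and `H d + 1` phases available. At the scale `ε / H`, the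
  -- condition on `ζ_elim` holds with equality.
  have key := M.le_oliveLaw gr hfin hregular hgr hq hch (ε := ε / H)
    (ya := H * (2 * Real.exp (-(p.nAct * (ε / H) ^ 2 / 16))))
    (ye := (productClass F).ncard *
      (2 * Real.exp (-(p.nElim * p.zetaElim ^ 2 / (16 * Fintype.card A)))))
    (by positivity) (by positivity) (mul_div_assoc _ _ _) hze0
    (le_of_eq (by
      rw [hze]
      field_simp)) hdim
    (fun f hf => M.dataLaw_actEstimate_le gr (hregular f hf) hn1 (by positivity)
      ((div_le_one (by positivity)).2 (hε1.trans hH')))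
    (fun f _ t => M.dataLaw_elimEstimate_le gr hfin hregular (gr f) t hn2 hze0 hze1)
    ((H * d + 1) * (p.nAct + p.nElim)) (H * d + 1) 1 (productClass F) 0 subset_rfl hq
    (fun _ => 0) (fun h => ⟨fun _ => 0, ⟨by simp, by simp⟩, by simp⟩) (by omega)
    (Nat.zero_add _).le
  refine le_trans ?_ (le_iSup (fun N => M.oliveLaw gr p ch N 1 (productClass F) 0 _) (H * d + 1))
  refine le_trans (ENNReal.ofReal_le_ofReal ?_) (key.trans (measure_mono ?_))
  · have := failure_le hcard hε hε1 hδ hδ1 hH hd hA hX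
    rw [← hp] at this
    linarith
  · rintro _ ⟨π, n, rfl, hopt, hn⟩
    refine ⟨π, n, rfl, ?_, ?_⟩
    · rwa [mul_div_cancel₀ _ (by positivity)] at hopt
    · exact (Nat.cast_le.2 hn).trans (episodes_le hcard hε hε1 hδ hH hd hA hX)
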